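/- Let $d\in\mathbb N$, let $s>1+\frac d2$ be a real number, and let $\phi\in H^s(\mathbb R^d)$ (complex valued). Let $\chi:\mathbb R^d\to\mathbb R^d$ be a $C^1$ diffeomorphism of $\mathbb R^d$ onto itself (bijective, with $\chi$ and $\chi^{-1}$ of class $C^1$) whose inverse has bounded derivative, $D(\chi^{-1})\in L^\infty(\mathbb R^d)$. Assume that $\chi\in W^{1+s-\frac d2,\infty}_{loc}(\mathbb R^d)$, $D\chi\in W^{1,\infty}(\mathbb R^d)$ and $D^2\chi\in H^{s-2}(\mathbb R^d)$. Then $\phi\circ\chi\in H^s(\mathbb R^d)$. Here $H^\sigma(\mathbb R^d)$, $\sigma\in\mathbb R$, is the usual $L^2$-based Sobolev space of tempered distributions $u$ with $(1+|\xi|^2)^{\sigma/2}\hat u\in L^2$. For real $r\ge 0$ and $k=\lfloor r\rfloor$, $W^{r,\infty}(\mathbb R^d)$ is the space of functions whose distributional derivatives of order at most $k$ are bounded and, if $r\notin\mathbb N$, whose derivatives of order $k$ are Hölder continuous with exponent $r-k$. A function $f$ is in $W^{r,\infty}_{loc}(\mathbb R^d)$ if $\psi f\in W^{r,\infty}(\mathbb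 R^d)$ for all $\psi\in C_0^\infty(\mathbb R^d)$. For maps and for derivatives such as $D\chi$, $D^2\chi$, membership is componentwise. -/

import Mathlib

open MeasureTheory TemperedDistribution
open scoped SchwartzMap LineDeriv ContDiff

/-- The Euclidean space `ℝ^d`. -/
abbrev Euc (d : ℕ) : Type := EuclideanSpace ℝ (Fin d)

/-- The tempered distribution `T` is the one given by the function `f`: for every Schwartz function
`g`, the product `g f` is integrable and `T g = ∫ g f`. -/
def Represents {d : ℕ} (T : 𝓢'(Euc d, ℂ)) (f : Euc d → ℂ) : Prop :=
  ∀ g : 𝓢(Euc d, ℂ), Integrable (fun x => g x * f x) ∧ T g = ∫ x, g x * f x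

/-- The function `f` belongs to `H^s(ℝ^d)`: it defines a tempered distribution, and this tempered
distribution lies in the `L²`-based Sobolev space of real order `s`. -/
def InHs {d : ℕ} (s : ℝ) (f : Euc d → ℂ) : Prop :=
  ∃ T : 𝓢'(Euc d, ℂ), Represents T f ∧ MemSobolev s 2 T

/-- The function `f` belongs to `W^{r,∞}(ℝ^d)`, for real `r ≥ 0`: with `k = ⌊r⌋`, the distributional
derivatives of `f` of order at most `k` are given by (measurable) bounded functions, and those of
order `k` are moreover Hölder continuous with exponent `r - k`. (If `r` is an integer the last
condition says no more than boundedness.) -/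
def InWInfty {d : ℕ} (r : ℝ) (f : Euc d → ℂ) : Prop :=
  ∃ T : 𝓢'(Euc d, ℂ), Represents T f ∧
    ∀ n : ℕ, n ≤ ⌊r⌋₊ → ∀ v : Fin n → Euc d,
      ∃ (h : Euc d → ℂ) (C : ℝ), Represents (∂^{v} T) h ∧ (∀ x, ‖h x‖ ≤ C) ∧
        (n = ⌊r⌋₊ → ∀ x y, ‖h x - h y‖ ≤ C * ‖x - y‖ ^ (r - (⌊r⌋₊ : ℝ)))

/-- The function `f` belongs to `W^{r,∞}_loc(ℝ^d)`: `ψ f` belongs to `W^{r,∞}(ℝ^d)` for every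
smooth compactly supported `ψ`. -/
def InWInftyLoc {d : ℕ} (r : ℝ) (f : Euc d → ℂ) : Prop :=
  ∀ ψ : Euc d → ℂ, ContDiff ℝ ∞ ψ → HasCompactSupport ψ → InWInfty r (fun x => ψ x * f x)

/-- The `i`-th component of a map `χ : ℝ^d → ℝ^d`, as a complex-valued function. -/
def component {d : ℕ} (χ : Euc d → Euc d) (i : Fin d) : Euc d → ℂ := fun x => ((χ x i : ℝ) : ℂ)

/-- `D²χ ∈ H^r(ℝ^d)`: every component of `χ` defines a tempered distribution, all of whose second
order derivatives belong to `H^r(ℝ^d)`. -/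
def HessianInHs {d : ℕ} (r : ℝ) (χ : Euc d → Euc d) : Prop :=
  ∀ i : Fin d, ∃ T : 𝓢'(Euc d, ℂ), Represents T (component χ i) ∧
    ∀ v w : Euc d, MemSobolev r 2 (∂_{v} (∂_{w} T))

/-! Everything is reduced to operators on L². Composition with `χ` is bounded on L² because `det
D(χ⁻¹)` is bounded, and the chain rule ∂ⱼ(f∘χ) = ∑ᵢ ∂ⱼχᵢ · (∂ᵢf)∘χ with bounded ∂ⱼχᵢ makes it
bounded on H¹. Interpolation gives H^t for 0 < t < 1 (`sobolevSq_map_ne_top_of_interpolation`). For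
t > 1 the order drops by one: ∂ᵢf lies in H^{t-1}, composition keeps it there by induction, and it
remains to multiply by ∂ⱼχᵢ within H^{t-1}, where t - 1 ≤ s - 1.

Put m = s - 1 > d/2. The factor a = ∂ⱼχᵢ is bounded, and its gradient is bounded and in H^{m-1}. The
same induction (`sobolevSq_map_ne_top_of_step`), now fed with ∂ₖ(af) = (∂ₖa)f + a∂ₖf, shows that a
multiplies H^t for 0 ≤ t ≤ m (`sobolevSq_mulL2_ne_top`). The term (∂ₖa)f is handled by the product
estimate H^{m-1}·H^t ⊂ H^{t-1}, 1 ≤ t ≤ m (`sobolevSq_mul_ne_top`), proved on the Fourier side with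
Young's inequality; this is where m > d/2 enters.

Both derivative rules are checked on Schwartz functions only. They pass to H¹ by density, since the
weak derivative is a closed relation on L². -/

namespace SobolevComposition

open FourierTransform
open scoped ENNReal

/-- Square integrable complex-valued functions on `ℝ^d`. -/
abbrev L2 (d : ℕ) : Type := Lp ℂ 2 (volume : Measure (Euc d))

variable {d : ℕ}

/-! ### Functions representing tempered distributions -/

theorem _root_.Represents.congr_ae {T : 𝓢'(Euc d, ℂ)} {f g : Euc d → ℂ} (hf : Represents T f)
    (h : f =ᵐ[volume] g) : Represents T g := by
  intro u
  have hu : (fun x => u x * f x) =ᵐ[volume] fun x => u x * g x := by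
    filter_upwards [h] with x hx
    rw [hx]
  exact ⟨(hf u).1.congr hu, (hf u).2.trans (integral_congr_ae hu)⟩

theorem represents_coe (F : L2 d) : Represents (F : 𝓢'(Euc d, ℂ)) F := by
  intro u
  refine ⟨(Lp.memLp F).integrable_mul (p := 2) (q := 2) (u.memLp 2) |>.congr ?_, ?_⟩
  · filter_upwards with x
    simp [mul_comm]
  · simp [Lp.toTemperedDistribution_apply]

theorem _root_.Represents.locallyIntegrable {T : 𝓢'(Euc d, ℂ)} {f : Euc d → ℂ} (hf : Represents T f) :
    LocallyIntegrable f := by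
  intro x
  -- The bump is `1` on the closed unit ball, so testing against it gives integrability of `f`
  -- itself there.
  let b : ContDiffBump x := ⟨1, 2, one_pos, one_lt_two⟩
  have hc : HasCompactSupport (Complex.ofRealCLM ∘ b) := b.hasCompactSupport.comp_left rfl
  have hb : ContDiff ℝ ∞ (Complex.ofRealCLM ∘ b) := Complex.ofRealCLM.contDiff.comp b.contDiff
  refine ⟨Metric.closedBall x 1, Metric.closedBall_mem_nhds x one_pos, ?_⟩
  refine ((hf (hc.toSchwartzMap hb)).1.integrableOn (s := Metric.closedBall x 1)).congr_fun ?_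
    measurableSet_closedBall
  intro y hy
  have : b y = 1 := b.one_of_mem_closedBall hy
  simp [this]

theorem _root_.Represents.ae_eq {T : 𝓢'(Euc d, ℂ)} {f g : Euc d → ℂ} (hf : Represents T f)
    (hg : Represents T g) : f =ᵐ[volume] g := by
  refine ae_eq_of_integral_contDiff_smul_eq hf.locallyIntegrable hg.locallyIntegrable ?_
  intro u hu hc
  have hc' : HasCompactSupport (Complex.ofRealCLM ∘ u) := hc.comp_left rfl
  have hu' : ContDiff ℝ ∞ (Complex.ofRealCLM ∘ u) := by fun_prop
  have h1 := (hf (hc'.toSchwartzMap hu')).2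
  have h2 := (hg (hc'.toSchwartzMap hu')).2
  simpa using h1.symm.trans h2

theorem represents_coe_iff {F : L2 d} {f : Euc d → ℂ} :
    Represents (F : 𝓢'(Euc d, ℂ)) f ↔ f =ᵐ[volume] F :=
  ⟨fun h => h.ae_eq (represents_coe F), fun h => Represents.congr_ae (represents_coe F) h.symm⟩

theorem coe_eq_of_represents {T : 𝓢'(Euc d, ℂ)} {F : L2 d} (h : Represents T F) :
    T = (F : 𝓢'(Euc d, ℂ)) := by
  ext u
  rw [(h u).2, (represents_coe F u).2]

/-! ### Sobolev norms -/

theorem fourier_sub (f g : L2 d) : (𝓕 (f - g) : L2 d) = 𝓕 f - 𝓕 g :=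
  (Lp.fourierTransformₗᵢ (Euc d) ℂ).map_sub f g

/-- The square of the norm of `f` in `H^t(ℝ^d)`, with values in `[0, ∞]`. -/
noncomputable def sobolevSq (t : ℝ) (f : L2 d) : ℝ≥0∞ :=
  ∫⁻ ξ, ENNReal.ofReal ((1 + ‖ξ‖ ^ 2) ^ t) * ‖(𝓕 f : L2 d) ξ‖ₑ ^ 2

theorem enorm_sq_eq_lintegral (f : L2 d) : ‖f‖ₑ ^ 2 = ∫⁻ x, ‖f x‖ₑ ^ 2 := by
  rw [Lp.enorm_def, eLpNorm_eq_lintegral_rpow_enorm_toReal (by norm_num) (by norm_num)]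
  rw [← ENNReal.rpow_natCast, ← ENNReal.rpow_mul]
  simp

theorem sobolevSq_zero (f : L2 d) : sobolevSq 0 f = ‖f‖ₑ ^ 2 := by
  have : ‖f‖ₑ = ‖(𝓕 f : L2 d)‖ₑ := by
    rw [← ofReal_norm, ← ofReal_norm, Lp.norm_fourier_eq]
  rw [this, enorm_sq_eq_lintegral]
  simp [sobolevSq]

theorem sobolevSq_mono {t t' : ℝ} (h : t ≤ t') (f : L2 d) : sobolevSq t f ≤ sobolevSq t' f := by
  refine lintegral_mono fun ξ => ?_
  gcongr
  simp

theorem hasTemperateGrowth_weight (t : ℝ) :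
    (fun ξ : Euc d => (((1 + ‖ξ‖ ^ 2) ^ (t / 2) : ℝ) : ℂ)).HasTemperateGrowth := by
  fun_prop

theorem enorm_weight_sq (t : ℝ) (ξ : Euc d) :
    ‖(((1 + ‖ξ‖ ^ 2) ^ (t / 2) : ℝ) : ℂ)‖ₑ ^ 2 = ENNReal.ofReal ((1 + ‖ξ‖ ^ 2) ^ t) := by
  rw [← ofReal_norm, Complex.norm_real, Real.norm_of_nonneg (by positivity),
    ← ENNReal.ofReal_pow (by positivity), ← Real.rpow_mul_natCast (by positivity)]
  congr 2; push_cast; ring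

theorem sobolevSq_ne_top_iff_memLp {t : ℝ} {f : L2 d} : sobolevSq t f ≠ ⊤ ↔
    MemLp (fun ξ => (((1 + ‖ξ‖ ^ 2) ^ (t / 2) : ℝ) : ℂ) * (𝓕 f : L2 d) ξ) 2 := by
  have hm : AEStronglyMeasurable (fun ξ => (((1 + ‖ξ‖ ^ 2) ^ (t / 2) : ℝ) : ℂ) * (𝓕 f : L2 d) ξ)
      volume :=
    (hasTemperateGrowth_weight t).1.continuous.aestronglyMeasurable.mul (Lp.aestronglyMeasurable _)
  rw [MemLp, eLpNorm_lt_top_iff_lintegral_rpow_enorm_lt_top (by norm_num) (by norm_num)]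
  simp only [hm, true_and, ENNReal.toReal_ofNat, sobolevSq, ← lt_top_iff_ne_top]
  refine iff_of_eq (congrArg (· < ⊤) (lintegral_congr fun ξ => ?_))
  rw [← enorm_weight_sq, ← mul_pow, ← enorm_mul]
  norm_cast

theorem memSobolev_coe_iff {t : ℝ} {f : L2 d} :
    MemSobolev t 2 (f : 𝓢'(Euc d, ℂ)) ↔ sobolevSq t f ≠ ⊤ := by
  have hg := hasTemperateGrowth_weight (d := d) t
  have hrep : Represents (smulLeftCLM ℂ (fun ξ : Euc d => (((1 + ‖ξ‖ ^ 2) ^ (t / 2) : ℝ) : ℂ))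
      (𝓕 (f : 𝓢'(Euc d, ℂ))))
      (fun ξ => (((1 + ‖ξ‖ ^ 2) ^ (t / 2) : ℝ) : ℂ) * (𝓕 f : L2 d) ξ) := by
    intro u
    have := represents_coe (𝓕 f : L2 d) (SchwartzMap.smulLeftCLM ℂ
      (fun ξ : Euc d => (((1 + ‖ξ‖ ^ 2) ^ (t / 2) : ℝ) : ℂ)) u)
    rw [Lp.fourier_toTemperedDistribution_eq, smulLeftCLM_apply_apply, this.2]
    simp_rw [SchwartzMap.smulLeftCLM_apply_apply hg] at this ⊢
    constructor
    · refine this.1.congr (.of_forall fun x => ?_)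
      simp only [smul_eq_mul]; ring
    · refine integral_congr_ae (.of_forall fun x => ?_)
      simp only [smul_eq_mul]; ring
  rw [memSobolev_iff_exists_smulLeftCLM_fourier, sobolevSq_ne_top_iff_memLp]
  constructor
  · rintro ⟨f', hf'⟩
    rw [hf'] at hrep
    exact (Lp.memLp f').ae_eq (represents_coe_iff.1 hrep).symm
  · intro h
    exact ⟨h.toLp, coe_eq_of_represents (Represents.congr_ae hrep h.coeFn_toLp.symm)⟩

/-- For `s ≥ 0` an element of H^s is an L² function, so the distributions can be dropped from here
on. -/
theorem inHs_iff {s : ℝ} (hs : 0 ≤ s) {f : Euc d → ℂ} :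
    InHs s f ↔ ∃ F : L2 d, f =ᵐ[volume] F ∧ sobolevSq s F ≠ ⊤ := by
  constructor
  · rintro ⟨T, hT, hs'⟩
    obtain ⟨F, rfl⟩ := memSobolev_zero_iff.1 (hs'.mono hs)
    exact ⟨F, represents_coe_iff.1 hT, memSobolev_coe_iff.1 hs'⟩
  · rintro ⟨F, hF, hs'⟩
    exact ⟨F, represents_coe_iff.2 hF, memSobolev_coe_iff.2 hs'⟩

/-! ### Weak derivatives -/

/-- `g` is the weak derivative of `f` in direction `v`. -/
def HasWeakDeriv (v : Euc d) (f g : L2 d) : Prop :=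
  ∂_{v} (f : 𝓢'(Euc d, ℂ)) = (g : 𝓢'(Euc d, ℂ))

theorem HasWeakDeriv.fourier_ae_eq {v : Euc d} {f g : L2 d} (h : HasWeakDeriv v f g) :
    ((𝓕 g : L2 d) : Euc d → ℂ) =ᵐ[volume]
      fun ξ => (2 * Real.pi * Complex.I) * ((inner ℝ ξ v : ℝ) : ℂ) * (𝓕 f : L2 d) ξ := by
  have h1 := congrArg 𝓕 h
  rw [TemperedDistribution.fourier_lineDerivOp_eq, Lp.fourier_toTemperedDistribution_eq,
    Lp.fourier_toTemperedDistribution_eq] at h1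
  refine ((represents_coe _).ae_eq (T := ((𝓕 g : L2 d) : 𝓢'(Euc d, ℂ))) ?_)
  rw [← h1]
  intro u
  have hg : (fun ξ : Euc d => ((inner ℝ ξ v : ℝ) : ℂ)).HasTemperateGrowth := by fun_prop
  have := represents_coe (𝓕 f : L2 d) (SchwartzMap.smulLeftCLM ℂ
      (fun ξ : Euc d => ((inner ℝ ξ v : ℝ) : ℂ)) u)
  have e : ((2 * Real.pi * Complex.I) • smulLeftCLM ℂ (fun ξ : Euc d => ((inner ℝ ξ v : ℝ) : ℂ))
      ((𝓕 f : L2 d) : 𝓢'(Euc d, ℂ))) u = (2 * Real.pi * Complex.I) *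
      (((𝓕 f : L2 d) : 𝓢'(Euc d, ℂ)) (SchwartzMap.smulLeftCLM ℂ
      (fun ξ : Euc d => ((inner ℝ ξ v : ℝ) : ℂ)) u)) := rfl
  rw [e, this.2]
  simp_rw [SchwartzMap.smulLeftCLM_apply_apply hg] at this ⊢
  constructor
  · refine (this.1.const_mul (2 * Real.pi * Complex.I)).congr (.of_forall fun x => ?_)
    simp only [smul_eq_mul]; ring
  · rw [← integral_const_mul]
    refine integral_congr_ae (.of_forall fun x => ?_)
    simp only [smul_eq_mul]; ring

/-- The `j`-th standard basis vector. -/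
noncomputable abbrev basisVec (j : Fin d) : Euc d := EuclideanSpace.single j 1

/-- By Plancherel this is (1+|ξ|²)^t = (1+|ξ|²)^{t-1}(1 + ∑ ξⱼ²). Being an identity in `[0, ∞]`, it
yields membership as well as estimates. -/
theorem sobolevSq_eq_add_sum {t : ℝ} {f : L2 d} {g : Fin d → L2 d}
    (h : ∀ j, HasWeakDeriv (basisVec j) f (g j)) :
    sobolevSq t f = sobolevSq (t - 1) f +
      ENNReal.ofReal ((2 * Real.pi) ^ 2)⁻¹ * ∑ j, sobolevSq (t - 1) (g j) := by
  have hm (u : L2 d) : AEMeasurable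
      (fun ξ => ENNReal.ofReal ((1 + ‖ξ‖ ^ 2) ^ (t - 1)) * ‖(u : Euc d → ℂ) ξ‖ₑ ^ 2) volume := by
    refine AEMeasurable.mul (Continuous.aemeasurable ?_) ((Lp.aestronglyMeasurable u).enorm.pow_const 2)
    refine ENNReal.continuous_ofReal.comp (Continuous.rpow_const (by fun_prop) ?_)
    intro x; left; positivity
  simp only [sobolevSq]
  rw [← lintegral_finsetSum' _ fun j _ => hm _, ← lintegral_const_mul'' _ (Finset.aemeasurable_fun_sum _ fun j _ => hm _),
    ← lintegral_add_left' (hm _)]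
  refine lintegral_congr_ae ?_
  filter_upwards [ae_all_iff.2 fun j => (h j).fourier_ae_eq] with ξ hξ
  have e (j : Fin d) : ‖(𝓕 (g j) : L2 d) ξ‖ₑ ^ 2 =
      ENNReal.ofReal ((2 * Real.pi) ^ 2 * (ξ j) ^ 2) * ‖(𝓕 f : L2 d) ξ‖ₑ ^ 2 := by
    rw [hξ j, enorm_mul, mul_pow]
    congr 1
    rw [← ofReal_norm, ← ENNReal.ofReal_pow (norm_nonneg _)]
    congr 1
    rw [norm_mul, mul_pow]
    simp [EuclideanSpace.inner_single_right, abs_of_pos Real.pi_pos]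
  simp_rw [e, ← mul_assoc, ← ENNReal.ofReal_mul (p := (1 + ‖ξ‖ ^ 2) ^ (t - 1)) (by positivity)]
  rw [← Finset.sum_mul, ← mul_assoc, ← add_mul, ← ENNReal.ofReal_sum_of_nonneg (fun i _ => by positivity),
    ← ENNReal.ofReal_mul (by positivity), ← ENNReal.ofReal_add (by positivity) (by positivity)]
  congr 2
  rw [← Finset.mul_sum, ← Finset.mul_sum, ← EuclideanSpace.real_norm_sq_eq]
  rw [Real.rpow_sub_one (by positivity)]
  have := Real.pi_pos
  field_simp

theorem exists_hasWeakDeriv {t : ℝ} (ht : 1 ≤ t) {f : L2 d} (hf : sobolevSq t f ≠ ⊤) (v : Euc d) :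
    ∃ g : L2 d, HasWeakDeriv v f g ∧ sobolevSq (t - 1) g ≠ ⊤ := by
  have h := (memSobolev_coe_iff.2 hf).lineDerivOp (m := v)
  obtain ⟨g, hg⟩ := memSobolev_zero_iff.1 (h.mono (sub_nonneg.2 ht))
  refine ⟨g, hg, ?_⟩
  rw [← memSobolev_coe_iff, ← hg]
  exact h

/-! ### Interpolation between `L²` and `H¹` -/

/-- This integral and the next recover the weight w^t from frequency cutoffs at level μ. Convergence
at 0 needs `t > 0`; convergence at infinity in the next one needs `t < 1`. -/
theorem lintegral_Ioi_rpow_sub_one_ite_lt {t w : ℝ} (ht : 0 < t) (hw : 0 < w) :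
    ∫⁻ μ in Set.Ioi (0 : ℝ), (if μ < w then ENNReal.ofReal (μ ^ (t - 1)) else 0) =
      ENNReal.ofReal (w ^ t / t) := by
  have e : ∀ μ : ℝ, (if μ < w then ENNReal.ofReal (μ ^ (t - 1)) else 0) =
      (Set.Iio w).indicator (fun μ => ENNReal.ofReal (μ ^ (t - 1))) μ := fun μ => by
    simp [Set.indicator_apply]
  simp_rw [e]
  rw [setLIntegral_indicator measurableSet_Iio, Set.Iio_inter_Ioi,
    setLIntegral_congr Ioo_ae_eq_Ioc]
  have hi := intervalIntegral.intervalIntegrable_rpow' (a := 0) (b := w) (r := t - 1) (by linarith)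
  rw [intervalIntegrable_iff_integrableOn_Ioc_of_le hw.le] at hi
  rw [← ofReal_integral_eq_lintegral_ofReal hi, ← intervalIntegral.integral_of_le hw.le,
    integral_rpow (Or.inl (by linarith))]
  · simp [Real.zero_rpow ht.ne']
  · filter_upwards [ae_restrict_mem measurableSet_Ioc] with μ hμ
    exact Real.rpow_nonneg hμ.1.le _

theorem lintegral_Ioi_rpow_sub_two_ite_le {t w : ℝ} (ht : t < 1) (hw : 0 < w) :
    ∫⁻ μ in Set.Ioi (0 : ℝ), (if w ≤ μ then ENNReal.ofReal (μ ^ (t - 2)) else 0) =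
      ENNReal.ofReal (w ^ (t - 1) / (1 - t)) := by
  have e : ∀ μ : ℝ, (if w ≤ μ then ENNReal.ofReal (μ ^ (t - 2)) else 0) =
      (Set.Ici w).indicator (fun μ => ENNReal.ofReal (μ ^ (t - 2))) μ := fun μ => by
    simp [Set.indicator_apply]
  simp_rw [e]
  rw [setLIntegral_indicator measurableSet_Ici,
    Set.inter_eq_left.2 (Set.Ici_subset_Ioi.2 hw), setLIntegral_congr Ioi_ae_eq_Ici.symm]
  have hi := integrableOn_Ioi_rpow_of_lt (a := t - 2) (by linarith) hw
  rw [← ofReal_integral_eq_lintegral_ofReal hi, integral_Ioi_rpow_of_lt (by linarith) hw]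
  · rw [show t - 2 + 1 = t - 1 by ring, neg_div, ← div_neg, neg_sub]
  · filter_upwards [ae_restrict_mem measurableSet_Ioi] with μ hμ
    exact Real.rpow_nonneg (hw.trans hμ).le _

theorem lintegral_mul_lintegral_ite_swap {S : Set (ℝ × Euc d)} [DecidablePred (· ∈ S)]
    (hS : MeasurableSet S) {k : ℝ → ℝ≥0∞} (hk : Measurable k) {G : Euc d → ℝ≥0∞}
    (hG : Measurable G) :
    ∫⁻ μ in Set.Ioi (0 : ℝ), k μ * ∫⁻ ξ, (if (μ, ξ) ∈ S then G ξ else 0) =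
      ∫⁻ ξ, (∫⁻ μ in Set.Ioi (0 : ℝ), (if (μ, ξ) ∈ S then k μ else 0)) * G ξ := by
  have hm : Measurable fun p : ℝ × Euc d => (if p ∈ S then k p.1 * G p.2 else 0) :=
    Measurable.ite hS ((hk.comp measurable_fst).mul (hG.comp measurable_snd)) measurable_const
  have h1 (μ : ℝ) : k μ * ∫⁻ ξ, (if (μ, ξ) ∈ S then G ξ else 0) =
      ∫⁻ ξ, (if (μ, ξ) ∈ S then k μ * G ξ else 0) := by
    rw [← lintegral_const_mul]
    · simp
    · exact Measurable.ite (measurable_prodMk_left hS) hG measurable_const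
  have h2 (ξ : Euc d) : (∫⁻ μ in Set.Ioi (0 : ℝ), (if (μ, ξ) ∈ S then k μ else 0)) * G ξ =
      ∫⁻ μ in Set.Ioi (0 : ℝ), (if (μ, ξ) ∈ S then k μ * G ξ else 0) := by
    rw [← lintegral_mul_const]
    · simp
    · exact Measurable.ite (measurable_prodMk_right hS) hk measurable_const
  simp_rw [h1, h2]
  exact lintegral_lintegral_swap hm.aemeasurable

/-- Splitting of an `L²` function into a low and a high frequency part. -/
theorem exists_frequency_splitting (f : L2 d) (μ : ℝ) :
    ∃ f₁ f₂ : L2 d, f = f₁ + f₂ ∧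
      (∀ᵐ ξ, (𝓕 f₁ : L2 d) ξ = if 1 + ‖ξ‖ ^ 2 ≤ μ then (𝓕 f : L2 d) ξ else 0) ∧
      (∀ᵐ ξ, (𝓕 f₂ : L2 d) ξ = if μ < 1 + ‖ξ‖ ^ 2 then (𝓕 f : L2 d) ξ else 0) := by
  classical
  let S : Set (Euc d) := {ξ | 1 + ‖ξ‖ ^ 2 ≤ μ}
  have hS : MeasurableSet S := measurableSet_le (by fun_prop) (by fun_prop)
  have h1 : MemLp (S.indicator (𝓕 f : L2 d)) 2 := (Lp.memLp _).indicator hS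
  have e1 : (𝓕 (𝓕⁻ h1.toLp : L2 d) : L2 d) = h1.toLp := fourier_fourierInv_eq _
  have e2 : (𝓕 (f - 𝓕⁻ h1.toLp : L2 d) : L2 d) = 𝓕 f - h1.toLp := by
    rw [fourier_sub, e1]
  refine ⟨𝓕⁻ h1.toLp, f - 𝓕⁻ h1.toLp, by abel, ?_, ?_⟩
  · rw [e1]
    filter_upwards [h1.coeFn_toLp] with ξ hξ
    rw [hξ, Set.indicator_apply]; rfl
  · rw [e2]
    filter_upwards [h1.coeFn_toLp, Lp.coeFn_sub (𝓕 f : L2 d) h1.toLp] with ξ hξ hξ'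
    rw [hξ', Pi.sub_apply, hξ, Set.indicator_apply]
    by_cases h : 1 + ‖ξ‖ ^ 2 ≤ μ
    · simp [S, h]
    · simp [S, h, not_le.1 h]

theorem enorm_add_sq_le (a b : ℂ) : ‖a + b‖ₑ ^ 2 ≤ 2 * ‖a‖ₑ ^ 2 + 2 * ‖b‖ₑ ^ 2 := by
  have h : ‖a + b‖ ^ 2 ≤ 2 * ‖a‖ ^ 2 + 2 * ‖b‖ ^ 2 := by
    nlinarith [norm_add_le a b, norm_nonneg (a + b), sq_nonneg (‖a‖ - ‖b‖)]
  simp only [← ofReal_norm, ← ENNReal.ofReal_pow (norm_nonneg _)]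
  rw [show (2 : ℝ≥0∞) = ENNReal.ofReal 2 by simp, ← ENNReal.ofReal_mul (by norm_num),
    ← ENNReal.ofReal_mul (by norm_num), ← ENNReal.ofReal_add (by positivity) (by positivity)]
  exact ENNReal.ofReal_le_ofReal h

/-- Split `f` at frequency level `μ`. The high part is estimated by the L² bound of `T`. The low
part is estimated by the H¹ bound: where `μ < 1 + ‖ξ‖ ^ 2`, the weight `μ⁻¹ (1 + ‖ξ‖ ^ 2)` is at
least 1. -/
theorem lintegral_high_frequency_map_le (T : L2 d →L[ℂ] L2 d) {C : ℝ≥0∞}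
    (hT : ∀ f, sobolevSq 1 (T f) ≤ C * sobolevSq 1 f) (f : L2 d) {μ : ℝ} (hμ : 0 < μ) :
    ∫⁻ ξ, (if μ < 1 + ‖ξ‖ ^ 2 then ‖(𝓕 (T f) : L2 d) ξ‖ₑ ^ 2 else 0) ≤
      2 * ‖T‖ₑ ^ 2 * (∫⁻ ξ, (if μ < 1 + ‖ξ‖ ^ 2 then ‖(𝓕 f : L2 d) ξ‖ₑ ^ 2 else 0)) +
      2 * C * (ENNReal.ofReal μ⁻¹ * ∫⁻ ξ, (if 1 + ‖ξ‖ ^ 2 ≤ μ then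
        ENNReal.ofReal (1 + ‖ξ‖ ^ 2) * ‖(𝓕 f : L2 d) ξ‖ₑ ^ 2 else 0)) := by
  obtain ⟨f₁, f₂, hf, h1, h2⟩ := exists_frequency_splitting f μ
  have hsum : ∀ᵐ ξ, (𝓕 (T f) : L2 d) ξ = (𝓕 (T f₂) : L2 d) ξ + (𝓕 (T f₁) : L2 d) ξ := by
    have : (𝓕 (T f) : L2 d) = 𝓕 (T f₂) + 𝓕 (T f₁) := by
      rw [hf, map_add, FourierTransform.fourier_add, add_comm]
    rw [this]
    exact Lp.coeFn_add _ _
  have hm (u : L2 d) : AEMeasurable (fun ξ => ‖(u : Euc d → ℂ) ξ‖ₑ ^ 2) volume :=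
    (Lp.aestronglyMeasurable u).enorm.pow_const 2
  calc ∫⁻ ξ, (if μ < 1 + ‖ξ‖ ^ 2 then ‖(𝓕 (T f) : L2 d) ξ‖ₑ ^ 2 else 0)
      ≤ ∫⁻ ξ, (2 * ‖(𝓕 (T f₂) : L2 d) ξ‖ₑ ^ 2 + 2 * (ENNReal.ofReal μ⁻¹ *
          (ENNReal.ofReal ((1 + ‖ξ‖ ^ 2) ^ (1 : ℝ)) * ‖(𝓕 (T f₁) : L2 d) ξ‖ₑ ^ 2))) := by
        refine lintegral_mono_ae ?_
        filter_upwards [hsum] with ξ hξ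
        split_ifs with h
        · rw [hξ]
          refine (enorm_add_sq_le _ _).trans ?_
          gcongr
          rw [← mul_assoc, ← ENNReal.ofReal_mul (by positivity)]
          refine le_mul_of_one_le_left (zero_le) ?_
          rw [ENNReal.one_le_ofReal, Real.rpow_one, inv_mul_eq_div, one_le_div hμ]
          exact h.le
        · exact zero_le
    _ = 2 * ‖T f₂‖ₑ ^ 2 + 2 * (ENNReal.ofReal μ⁻¹ * sobolevSq 1 (T f₁)) := by
        rw [lintegral_add_left' ((hm _).const_mul _), lintegral_const_mul'' _ (hm _),
          lintegral_const_mul' _ _ (by simp), lintegral_const_mul' _ _ (by simp), sobolevSq,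
          ← enorm_sq_eq_lintegral]
        congr 3
        rw [← ofReal_norm, ← ofReal_norm, Lp.norm_fourier_eq]
    _ ≤ 2 * (‖T‖ₑ * ‖f₂‖ₑ) ^ 2 + 2 * (ENNReal.ofReal μ⁻¹ * (C * sobolevSq 1 f₁)) := by
        gcongr
        · exact T.le_opENorm f₂
        · exact hT f₁
    _ = 2 * ‖T‖ₑ ^ 2 * ‖f₂‖ₑ ^ 2 + 2 * C * (ENNReal.ofReal μ⁻¹ * sobolevSq 1 f₁) := by ring
    _ = _ := by
        congr 2
        · rw [← sobolevSq_zero, sobolevSq]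
          refine lintegral_congr_ae ?_
          filter_upwards [h2] with ξ hξ
          rw [hξ]
          split_ifs <;> simp
        · congr 1
          rw [sobolevSq]
          refine lintegral_congr_ae ?_
          filter_upwards [h1] with ξ hξ
          rw [hξ]
          split_ifs <;> simp

/-- Integrating the cutoff estimate against μ^{t-1} dμ and applying Tonelli turns each of its three
terms into a constant multiple of an H^t norm squared. -/
theorem sobolevSq_map_ne_top_of_interpolation (T : L2 d →L[ℂ] L2 d) {C : ℝ≥0∞} (hC : C ≠ ⊤)
    (hT : ∀ f, sobolevSq 1 (T f) ≤ C * sobolevSq 1 f) {t : ℝ} (ht0 : 0 < t) (ht1 : t < 1)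
    {f : L2 d} (hf : sobolevSq t f ≠ ⊤) : sobolevSq t (T f) ≠ ⊤ := by
  classical
  have hw : Measurable fun p : ℝ × Euc d => 1 + ‖p.2‖ ^ 2 := by fun_prop
  have hS1 : MeasurableSet {p : ℝ × Euc d | p.1 < 1 + ‖p.2‖ ^ 2} := measurableSet_lt measurable_fst hw
  have hS2 : MeasurableSet {p : ℝ × Euc d | 1 + ‖p.2‖ ^ 2 ≤ p.1} := measurableSet_le hw measurable_fst
  have hk (r : ℝ) : Measurable fun μ : ℝ => ENNReal.ofReal (μ ^ r) := by fun_prop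
  have hG (u : L2 d) : Measurable fun ξ => ‖(u : Euc d → ℂ) ξ‖ₑ ^ 2 :=
    (Lp.stronglyMeasurable u).enorm.pow_const 2
  have hG' : Measurable fun ξ => ENNReal.ofReal (1 + ‖ξ‖ ^ 2) * ‖(𝓕 f : L2 d) ξ‖ₑ ^ 2 :=
    (by fun_prop : Measurable fun ξ : Euc d => ENNReal.ofReal (1 + ‖ξ‖ ^ 2)).mul (hG _)
  have high (u : L2 d) : ∫⁻ μ in Set.Ioi (0 : ℝ), ENNReal.ofReal (μ ^ (t - 1)) *
      ∫⁻ ξ, (if μ < 1 + ‖ξ‖ ^ 2 then ‖(𝓕 u : L2 d) ξ‖ₑ ^ 2 else 0) =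
      ENNReal.ofReal t⁻¹ * sobolevSq t u := by
    have := lintegral_mul_lintegral_ite_swap hS1 (hk (t - 1)) (hG (𝓕 u))
    simp only [Set.mem_ofPred_eq] at this
    rw [this, sobolevSq, ← lintegral_const_mul' _ _ (by simp)]
    refine lintegral_congr fun ξ => ?_
    rw [lintegral_Ioi_rpow_sub_one_ite_lt ht0 (by positivity), div_eq_inv_mul,
      ENNReal.ofReal_mul (by positivity), mul_assoc]
  have low : ∫⁻ μ in Set.Ioi (0 : ℝ), ENNReal.ofReal (μ ^ (t - 2)) *
      ∫⁻ ξ, (if 1 + ‖ξ‖ ^ 2 ≤ μ then ENNReal.ofReal (1 + ‖ξ‖ ^ 2) * ‖(𝓕 f : L2 d) ξ‖ₑ ^ 2 else 0) =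
      ENNReal.ofReal (1 - t)⁻¹ * sobolevSq t f := by
    have := lintegral_mul_lintegral_ite_swap hS2 (hk (t - 2)) hG'
    simp only [Set.mem_ofPred_eq] at this
    rw [this, sobolevSq, ← lintegral_const_mul' _ _ (by simp)]
    refine lintegral_congr fun ξ => ?_
    have : 0 < 1 - t := by linarith
    rw [lintegral_Ioi_rpow_sub_two_ite_le ht1 (by positivity), ← mul_assoc, ← mul_assoc,
      ← ENNReal.ofReal_mul (by positivity), ← ENNReal.ofReal_mul (by positivity)]
    congr 2
    rw [Real.rpow_sub_one (by positivity)]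
    field_simp
  have main : ENNReal.ofReal t⁻¹ * sobolevSq t (T f) ≤
      2 * ‖T‖ₑ ^ 2 * (ENNReal.ofReal t⁻¹ * sobolevSq t f) +
      2 * C * (ENNReal.ofReal (1 - t)⁻¹ * sobolevSq t f) := by
    rw [← high, ← high, ← low, ← lintegral_const_mul' _ _ (by finiteness),
      ← lintegral_const_mul' _ _ (by finiteness), ← lintegral_add_left']
    · refine setLIntegral_mono_ae' measurableSet_Ioi (.of_forall fun μ hμ => ?_)
      have hμ : 0 < μ := hμ
      refine (mul_le_mul_right (lintegral_high_frequency_map_le T hT f hμ) _).trans_eq ?_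
      have e : ENNReal.ofReal (μ ^ (t - 2)) = ENNReal.ofReal (μ ^ (t - 1)) * ENNReal.ofReal μ⁻¹ := by
        rw [← ENNReal.ofReal_mul (by positivity), ← Real.rpow_neg_one, ← Real.rpow_add hμ]
        congr 2; ring
      rw [e]
      ring
    · refine (Measurable.const_mul ((hk _).mul ?_) _).aemeasurable
      exact Measurable.lintegral_prod_right' (f := fun p : ℝ × Euc d =>
        if p.1 < 1 + ‖p.2‖ ^ 2 then ‖(𝓕 f : L2 d) p.2‖ₑ ^ 2 else 0)
        (Measurable.ite hS1 ((hG _).comp measurable_snd) measurable_const)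
  intro h
  rw [h, ENNReal.mul_top (by simpa using ht0)] at main
  exact absurd main (not_le.2 (by finiteness))

/-! ### Approximation by Schwartz functions -/

/-- The weighted Fourier transform of `f` is in L². Approximate it there by a Schwartz function,
divide by the weight and transform back. -/
theorem exists_schwartz_sobolevSq_sub_lt {t : ℝ} {f : L2 d} (hf : sobolevSq t f ≠ ⊤) {ε : ℝ}
    (hε : 0 < ε) : ∃ h : 𝓢(Euc d, ℂ), sobolevSq t (f - h.toLp 2 volume) < ENNReal.ofReal (ε ^ 2) := by
  have hw := sobolevSq_ne_top_iff_memLp.1 hf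
  obtain ⟨v, hv⟩ := (SchwartzMap.denseRange_toLpCLM (F := ℂ) (p := 2)
    (μ := (volume : Measure (Euc d))) (by simp)).exists_dist_lt hw.toLp hε
  rw [SchwartzMap.toLpCLM_apply] at hv
  have hg := hasTemperateGrowth_weight (d := d) (-t)
  let u := SchwartzMap.smulLeftCLM ℂ (fun ξ : Euc d => (((1 + ‖ξ‖ ^ 2) ^ (-t / 2) : ℝ) : ℂ)) v
  refine ⟨𝓕⁻ u, ?_⟩
  have e : (𝓕 (f - (𝓕⁻ u).toLp 2 volume : L2 d) : L2 d) = 𝓕 f - u.toLp 2 volume := by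
    rw [fourier_sub, SchwartzMap.toLp_fourier_eq, fourier_fourierInv_eq]
  have key : sobolevSq t (f - (𝓕⁻ u).toLp 2 volume) = ‖hw.toLp - v.toLp 2 volume‖ₑ ^ 2 := by
    rw [enorm_sq_eq_lintegral, sobolevSq, e]
    refine lintegral_congr_ae ?_
    filter_upwards [Lp.coeFn_sub (𝓕 f : L2 d) (u.toLp 2 volume), Lp.coeFn_sub hw.toLp (v.toLp 2 volume),
      hw.coeFn_toLp, u.coeFn_toLp 2 volume, v.coeFn_toLp 2 volume] with ξ h1 h2 h3 h4 h5
    rw [h1, h2, Pi.sub_apply, Pi.sub_apply, h3, h4, h5, ← enorm_weight_sq, ← mul_pow, ← enorm_mul,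
      mul_sub, SchwartzMap.smulLeftCLM_apply_apply hg, smul_eq_mul, ← mul_assoc, ← Complex.ofReal_mul,
      ← Real.rpow_add (by positivity)]
    simp [neg_div]
  rw [key, ← ofReal_norm, ← dist_eq_norm, ← ENNReal.ofReal_pow dist_nonneg]
  refine (ENNReal.ofReal_lt_ofReal_iff (by positivity)).2 ?_
  gcongr

theorem HasWeakDeriv.sub {v : Euc d} {f f' g g' : L2 d} (h : HasWeakDeriv v f g)
    (h' : HasWeakDeriv v f' g') : HasWeakDeriv v (f - f') (g - g') := by
  simp only [HasWeakDeriv, ← Lp.toTemperedDistributionCLM_apply, map_sub] at *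
  rw [← h, ← h', sub_eq_add_neg, LineDerivAdd.lineDerivOp_add, ← neg_one_smul ℂ, LineDerivSMul.lineDerivOp_smul, neg_one_smul,
    sub_eq_add_neg]

theorem hasWeakDeriv_schwartz (v : Euc d) (h : 𝓢(Euc d, ℂ)) :
    HasWeakDeriv v (h.toLp 2 volume) ((∂_{v} h).toLp 2 volume) := by
  rw [HasWeakDeriv, Lp.toTemperedDistribution_toLp_eq, Lp.toTemperedDistribution_toLp_eq,
    lineDerivOp_toTemperedDistributionCLM_eq]

theorem isClosed_hasWeakDeriv (v : Euc d) : IsClosed {p : L2 d × L2 d | HasWeakDeriv v p.1 p.2} := by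
  refine isClosed_eq ?_ ?_
  · exact ((LineDeriv.lineDerivOpCLM ℂ 𝓢'(Euc d, ℂ) v) ∘L
      (Lp.toTemperedDistributionCLM ℂ volume 2)).continuous.comp continuous_fst
  · exact (Lp.toTemperedDistributionCLM ℂ volume 2).continuous.comp continuous_snd

theorem enorm_sq_le_of_hasWeakDeriv {f : L2 d} {g : Fin d → L2 d}
    (h : ∀ j, HasWeakDeriv (basisVec j) f (g j)) :
    ‖f‖ₑ ^ 2 ≤ sobolevSq 1 f ∧
      ∀ j, ‖g j‖ₑ ^ 2 ≤ ENNReal.ofReal ((2 * Real.pi) ^ 2) * sobolevSq 1 f := by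
  have e := sobolevSq_eq_add_sum (t := 1) h
  simp only [sub_self, sobolevSq_zero] at e
  refine ⟨e ▸ le_self_add, fun j => ?_⟩
  have hj : ‖g j‖ₑ ^ 2 ≤ ∑ i, ‖g i‖ₑ ^ 2 :=
    Finset.single_le_sum (f := fun i => ‖g i‖ₑ ^ 2) (fun i _ => zero_le) (Finset.mem_univ j)
  rw [e, mul_add, ← mul_assoc, ← ENNReal.ofReal_mul (by positivity),
    mul_inv_cancel₀ (by have := Real.pi_pos; positivity), ENNReal.ofReal_one, one_mul]
  exact hj.trans le_add_self

theorem sobolevSq_one_ne_top {f : L2 d} {g : Fin d → L2 d}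
    (h : ∀ j, HasWeakDeriv (basisVec j) f (g j)) : sobolevSq 1 f ≠ ⊤ := by
  rw [sobolevSq_eq_add_sum h]
  simp only [sub_self, sobolevSq_zero]
  refine ENNReal.add_ne_top.2 ⟨by finiteness, ENNReal.mul_ne_top (by simp) ?_⟩
  exact ENNReal.sum_ne_top.2 fun j _ => by finiteness

theorem mem_closure_range_schwartz {f : L2 d} {g : Fin d → L2 d}
    (h : ∀ j, HasWeakDeriv (basisVec j) f (g j)) :
    (f, g) ∈ closure (Set.range fun u : 𝓢(Euc d, ℂ) =>
      ((u.toLp 2 volume : L2 d), fun j => ((∂_{basisVec j} u).toLp 2 volume : L2 d))) := by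
  rw [Metric.mem_closure_iff]
  intro ε hε
  have hpi := Real.pi_gt_three
  -- A derivative costs a factor 2π in norm, hence ε / 2π; since 2π ≥ 1 this also suffices for `f`
  -- itself.
  obtain ⟨u, hu⟩ := exists_schwartz_sobolevSq_sub_lt (sobolevSq_one_ne_top h)
    (ε := ε / (2 * Real.pi)) (by positivity)
  obtain ⟨h0, h1⟩ := enorm_sq_le_of_hasWeakDeriv
    fun j => (h j).sub (hasWeakDeriv_schwartz (basisVec j) u)
  refine ⟨_, ⟨u, rfl⟩, ?_⟩
  rw [Prod.dist_eq]
  refine max_lt ?_ ((dist_pi_lt_iff hε).2 fun j => ?_)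
  · have := h0.trans_lt hu
    rw [← ofReal_norm, ← ENNReal.ofReal_pow (norm_nonneg _),
      ENNReal.ofReal_lt_ofReal_iff (by positivity)] at this
    rw [dist_eq_norm]
    refine (lt_of_pow_lt_pow_left₀ 2 (by positivity) this).trans_le ?_
    exact div_le_self hε.le (by linarith)
  · have := (h1 j).trans_lt (ENNReal.mul_lt_mul_right (a := ENNReal.ofReal ((2 * Real.pi) ^ 2)) (by simp) (by simp) hu)
    rw [← ofReal_norm, ← ENNReal.ofReal_pow (norm_nonneg _), ← ENNReal.ofReal_mul (by positivity),
      ENNReal.ofReal_lt_ofReal_iff (by positivity), ← mul_pow, mul_div_cancel₀ _ (by positivity)] at this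
    rw [dist_eq_norm]
    exact lt_of_pow_lt_pow_left₀ 2 hε.le this

/-! ### Operators satisfying a derivative rule -/

/-- The derivative of `T f` in direction `v` is `A₀ f + ∑ i, A i (∂ᵢ f)`, for Schwartz `f`. -/
def HasDerivRule (v : Euc d) (T A₀ : L2 d →L[ℂ] L2 d) (A : Fin d → L2 d →L[ℂ] L2 d) : Prop :=
  ∀ u : 𝓢(Euc d, ℂ), HasWeakDeriv v (T (u.toLp 2 volume))
    (A₀ (u.toLp 2 volume) + ∑ i, A i ((∂_{basisVec i} u).toLp 2 volume))

/-- Both sides depend continuously on `(f, g)` in L², weak differentiation has closed graph, and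
Schwartz functions with their gradients are dense among such pairs. -/
theorem HasDerivRule.hasWeakDeriv {v : Euc d} {T A₀ : L2 d →L[ℂ] L2 d}
    {A : Fin d → L2 d →L[ℂ] L2 d} (hT : HasDerivRule v T A₀ A) {f : L2 d} {g : Fin d → L2 d}
    (h : ∀ j, HasWeakDeriv (basisVec j) f (g j)) :
    HasWeakDeriv v (T f) (A₀ f + ∑ i, A i (g i)) := by
  have hcont : Continuous fun p : L2 d × (Fin d → L2 d) => (T p.1, A₀ p.1 + ∑ i, A i (p.2 i)) := by
    refine (T.continuous.comp continuous_fst).prodMk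
      ((A₀.continuous.comp continuous_fst).add (continuous_finsetSum _ fun i _ => ?_))
    exact (A i).continuous.comp ((continuous_apply i).comp continuous_snd)
  have hc := (isClosed_hasWeakDeriv v).preimage hcont
  have hmem := closure_minimal (Set.range_subset_iff.2 fun u => ?_) hc
    (mem_closure_range_schwartz h)
  · exact hmem
  · exact hT u

theorem sobolevSq_one_map_le {T : L2 d →L[ℂ] L2 d} {A₀ : Fin d → L2 d →L[ℂ] L2 d}
    {A : Fin d → Fin d → L2 d →L[ℂ] L2 d}
    (hT : ∀ j, HasDerivRule (basisVec j) T (A₀ j) (A j)) :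
    ∃ C : ℝ≥0∞, C ≠ ⊤ ∧ ∀ f, sobolevSq 1 (T f) ≤ C * sobolevSq 1 f := by
  let c : ℝ≥0∞ := ENNReal.ofReal ((2 * Real.pi) ^ 2)⁻¹
  let b : ℝ≥0∞ := ENNReal.ofReal (2 * Real.pi)
  -- The summand `1` keeps `C` nonzero, so that `C * ⊤ = ⊤` when `f` is not in H¹.
  let C : ℝ≥0∞ := 1 + ‖T‖ₑ ^ 2 + c * ∑ j, (‖A₀ j‖ₑ + ∑ i, ‖A j i‖ₑ * b) ^ 2
  have hC : C ≠ ⊤ := by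
    refine ENNReal.add_ne_top.2 ⟨by finiteness, ENNReal.mul_ne_top (by simp [c]) ?_⟩
    refine ENNReal.sum_ne_top.2 fun j _ => ENNReal.pow_ne_top (ENNReal.add_ne_top.2 ⟨by finiteness, ?_⟩)
    exact ENNReal.sum_ne_top.2 fun i _ => ENNReal.mul_ne_top (by finiteness) ENNReal.ofReal_ne_top
  refine ⟨C, hC, fun f => ?_⟩
  by_cases hf : sobolevSq 1 f = ⊤
  · rw [hf, ENNReal.mul_top]
    · exact le_top
    · simp [C]
  choose g hg _ using fun j => exists_hasWeakDeriv le_rfl hf (basisVec (d := d) j)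
  obtain ⟨h0, h1⟩ := enorm_sq_le_of_hasWeakDeriv hg
  have e := sobolevSq_eq_add_sum (t := 1) fun j => (hT j).hasWeakDeriv hg
  simp only [sub_self, sobolevSq_zero] at e
  obtain ⟨n, hn⟩ : ∃ n : ℝ≥0∞, n ^ 2 = sobolevSq 1 f :=
    ⟨sobolevSq 1 f ^ (1 / 2 : ℝ), by rw [← ENNReal.rpow_natCast, ← ENNReal.rpow_mul]; simp⟩
  have hb : ENNReal.ofReal ((2 * Real.pi) ^ 2) = b ^ 2 := by
    rw [ENNReal.ofReal_pow (by have := Real.pi_pos; positivity)]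
  rw [← hn] at h0 h1 ⊢
  simp_rw [hb, ← mul_pow] at h1
  have h0' : ‖f‖ₑ ≤ n := (ENNReal.pow_le_pow_left_iff two_ne_zero).1 h0
  have h1' (j) : ‖g j‖ₑ ≤ b * n := (ENNReal.pow_le_pow_left_iff two_ne_zero).1 (h1 j)
  rw [e]
  calc _ ≤ (‖T‖ₑ * n) ^ 2 + c * ∑ j, ((‖A₀ j‖ₑ + ∑ i, ‖A j i‖ₑ * b) * n) ^ 2 := by
        gcongr with j _
        · exact (T.le_opENorm f).trans (by gcongr)
        · refine (enorm_add_le _ _).trans ?_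
          rw [add_mul, Finset.sum_mul]
          gcongr
          · exact ((A₀ j).le_opENorm f).trans (by gcongr)
          · refine (enorm_sum_le _ _).trans (Finset.sum_le_sum fun i _ => ?_)
            rw [mul_assoc]
            exact ((A j i).le_opENorm _).trans (by gcongr; exact h1' i)
    _ = (‖T‖ₑ ^ 2 + c * ∑ j, (‖A₀ j‖ₑ + ∑ i, ‖A j i‖ₑ * b) ^ 2) * n ^ 2 := by
        simp_rw [mul_pow _ n, ← Finset.sum_mul]
        ring
    _ ≤ C * n ^ 2 := by
        gcongr
        simp only [C, add_assoc]
        exact le_add_self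

theorem sobolevSq_map_ne_top_of_le_one {T : L2 d →L[ℂ] L2 d} {A₀ : Fin d → L2 d →L[ℂ] L2 d}
    {A : Fin d → Fin d → L2 d →L[ℂ] L2 d}
    (hT : ∀ j, HasDerivRule (basisVec j) T (A₀ j) (A j)) {t : ℝ} (ht0 : 0 ≤ t) (ht1 : t ≤ 1)
    {f : L2 d} (hf : sobolevSq t f ≠ ⊤) : sobolevSq t (T f) ≠ ⊤ := by
  obtain ⟨C, hC, h⟩ := sobolevSq_one_map_le hT
  rcases ht0.eq_or_lt with rfl | ht0
  · rw [sobolevSq_zero]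
    finiteness
  rcases ht1.eq_or_lt with rfl | ht1
  · exact ne_top_of_le_ne_top (ENNReal.mul_ne_top hC hf) (h f)
  · exact sobolevSq_map_ne_top_of_interpolation T hC h ht0 ht1 hf

/-! ### Classical and weak derivatives -/

/-- Integration by parts. `f` need not be bounded, which allows the components of `χ` themselves. -/
theorem represents_lineDerivOp {T : 𝓢'(Euc d, ℂ)} {f : Euc d → ℂ} (hT : Represents T f)
    (hf : Differentiable ℝ f) (v : Euc d)
    (hi : ∀ g : 𝓢(Euc d, ℂ), Integrable fun x => g x * fderiv ℝ f x v) :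
    Represents (∂_{v} T) (fun x => fderiv ℝ f x v) := by
  intro g
  refine ⟨hi g, ?_⟩
  have h := integral_mul_fderiv_eq_neg_fderiv_mul_of_integrable (μ := volume) (f := g) (g := f)
    (v := v) (hT (∂_{v} g)).1 (hi g) (hT g).1 (fun x _ => g.differentiableAt) (fun x _ => hf x)
  rw [h, lineDerivOp_apply_apply, map_neg, (hT (∂_{v} g)).2]
  rfl

theorem integrable_schwartz_mul_bounded (g : 𝓢(Euc d, ℂ)) {f : Euc d → ℂ} (hf : MemLp f ⊤ volume) :
    Integrable fun x => g x * f x :=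
  (g.memLp 1).integrable_mul (p := 1) (q := ⊤) hf

/-! ### Multiplication by a bounded function -/

/-- Multiplication by a bounded function, as an operator on `L²`. -/
noncomputable def mulL2 {a : Euc d → ℂ} (ha : MemLp a ⊤ volume) : L2 d →L[ℂ] L2 d :=
  LinearMap.mkContinuous
    { toFun := fun f => (ha.toLp • f : L2 d)
      map_add' := fun f g => by
        refine Lp.ext ?_
        filter_upwards [Lp.coeFn_lpSMul (r := 2) ha.toLp (f + g), Lp.coeFn_lpSMul (r := 2) ha.toLp f,
          Lp.coeFn_lpSMul (r := 2) ha.toLp g, Lp.coeFn_add f g,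
          Lp.coeFn_add (ha.toLp • f : L2 d) (ha.toLp • g)] with x h1 h2 h3 h4 h5
        rw [h1, h5, Pi.add_apply, h2, h3, Pi.smul_apply', h4, Pi.add_apply, smul_add]
        rfl
      map_smul' := fun c f => by
        refine Lp.ext ?_
        filter_upwards [Lp.coeFn_lpSMul (r := 2) ha.toLp (c • f), Lp.coeFn_lpSMul (r := 2) ha.toLp f,
          Lp.coeFn_smul c f, Lp.coeFn_smul c (ha.toLp • f : L2 d)] with x h1 h2 h3 h4
        simp only [RingHom.id_apply]
        rw [h1, h4, Pi.smul_apply, h2]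
        simp [h3, mul_left_comm] }
    ‖ha.toLp‖ fun f => Lp.norm_smul_le _ _

theorem coeFn_mulL2 {a : Euc d → ℂ} (ha : MemLp a ⊤ volume) (f : L2 d) :
    (mulL2 ha f : Euc d → ℂ) =ᵐ[volume] fun x => a x * f x := by
  have h : mulL2 ha f = (ha.toLp • f : L2 d) := rfl
  rw [h]
  filter_upwards [Lp.coeFn_lpSMul (r := 2) ha.toLp f, ha.coeFn_toLp] with x h1 h2
  simp [h1, h2]

theorem coeFn_sum_mulL2 {ι : Type*} [Fintype ι] {a : ι → Euc d → ℂ}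
    (ha : ∀ i, MemLp (a i) ⊤ volume) (f : ι → L2 d) :
    (∑ i, mulL2 (ha i) (f i) : L2 d) =ᵐ[volume] fun x => ∑ i, a i x * f i x := by
  filter_upwards [Lp.coeFn_fun_finsetSum Finset.univ fun i => mulL2 (ha i) (f i),
    ae_all_iff.2 fun i => coeFn_mulL2 (ha i) (f i)] with x h1 h2
  rw [h1]
  exact Finset.sum_congr rfl fun i _ => h2 i

theorem hasDerivRule_mulL2 {a h : Euc d → ℂ} (ha : MemLp a ⊤ volume) (hh : MemLp h ⊤ volume)
    {T : 𝓢'(Euc d, ℂ)} (hT : Represents T a) (j : Fin d) (hT' : Represents (∂_{basisVec j} T) h) :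
    HasDerivRule (basisVec j) (mulL2 ha) (mulL2 hh) (fun i => if i = j then mulL2 ha else 0) := by
  intro u
  have hsum : ∑ i, (if i = j then mulL2 ha else 0) ((∂_{basisVec i} u).toLp 2 volume) =
      mulL2 ha ((∂_{basisVec j} u).toLp 2 volume) := by
    rw [Finset.sum_eq_single j] <;> simp +contextual
  rw [hsum]
  refine coe_eq_of_represents ?_
  have hrep : Represents (mulL2 ha (u.toLp 2) : 𝓢'(Euc d, ℂ)) (fun x => a x * u x) := by
    refine Represents.congr_ae (represents_coe _) ?_
    filter_upwards [coeFn_mulL2 ha (u.toLp 2), u.coeFn_toLp 2 volume] with x h1 h2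
    rw [h1, h2]
  have hg : (fun x => u x).HasTemperateGrowth := u.hasTemperateGrowth
  have main : Represents (∂_{basisVec j} (mulL2 ha (u.toLp 2) : 𝓢'(Euc d, ℂ)))
      (fun x => h x * u x + a x * (∂_{basisVec j} u) x) := by
    intro g
    have hgg : (fun x => g x).HasTemperateGrowth := g.hasTemperateGrowth
    have i1 := hT' (SchwartzMap.smulLeftCLM ℂ u g)
    have i2 := hT (SchwartzMap.smulLeftCLM ℂ g (∂_{basisVec j} u))
    have i3 := hT (SchwartzMap.smulLeftCLM ℂ u (∂_{basisVec j} g))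
    -- `a` is only weakly differentiable, so the Leibniz rule is applied to the Schwartz product `u
    -- g` and transferred to `a u` by duality.
    have e : ∂_{basisVec j} (SchwartzMap.smulLeftCLM ℂ u g) =
        SchwartzMap.smulLeftCLM ℂ u (∂_{basisVec j} g) +
          SchwartzMap.smulLeftCLM ℂ g (∂_{basisVec j} u) := by
      ext x
      rw [SchwartzMap.lineDerivOp_apply_eq_fderiv, SchwartzMap.smulLeftCLM_apply hg]
      simp only [_root_.add_apply, SchwartzMap.smulLeftCLM_apply_apply hg,
        SchwartzMap.smulLeftCLM_apply_apply hgg, SchwartzMap.lineDerivOp_apply_eq_fderiv, smul_eq_mul]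
      rw [fderiv_fun_mul u.differentiableAt g.differentiableAt]
      simp
    have e2 := i1.2
    rw [lineDerivOp_apply_apply, map_neg, e, map_add, i2.2] at e2
    simp only [SchwartzMap.smulLeftCLM_apply_apply hg, SchwartzMap.smulLeftCLM_apply_apply hgg,
      smul_eq_mul] at i1 i2 i3 e2
    have e3 : (fun x => g x * (h x * u x + a x * (∂_{basisVec j} u) x)) =
        fun x => u x * g x * h x + g x * (∂_{basisVec j} u) x * a x := by
      ext x; ring
    rw [e3]
    refine ⟨i1.1.add i2.1, ?_⟩
    rw [integral_add i1.1 i2.1, ← e2, lineDerivOp_apply_apply, map_neg, (hrep _).2, i3.2]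
    have : ∫ x, (∂_{basisVec j} g) x * (a x * u x) = ∫ x, u x * (∂_{basisVec j} g) x * a x :=
      integral_congr_ae (.of_forall fun x => by ring)
    rw [this]
    ring
  refine main.congr_ae ?_
  filter_upwards [coeFn_mulL2 hh (u.toLp 2), u.coeFn_toLp 2 volume,
    coeFn_mulL2 ha ((∂_{basisVec j} u).toLp 2), (∂_{basisVec j} u).coeFn_toLp 2 volume,
    Lp.coeFn_add (mulL2 hh (u.toLp 2)) (mulL2 ha ((∂_{basisVec j} u).toLp 2))] with x h1 h2 h3 h4 h5
  rw [h5, Pi.add_apply, h1, h2, h3, h4]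

/-! ### Composition with a map -/

/-- Composition with a map whose preimages do not increase volume by more than a constant factor,
as an operator on `L²`. -/
noncomputable def compL2 {χ : Euc d → Euc d} (hχ : Measurable χ) {K : ℝ≥0∞} (hK : K ≠ ⊤)
    (h : Measure.map χ volume ≤ K • volume) : L2 d →L[ℂ] L2 d :=
  have hq : Measure.QuasiMeasurePreserving χ volume volume :=
    ⟨hχ, Measure.absolutelyContinuous_of_le_smul h⟩
  have hm (f : L2 d) : MemLp (f ∘ χ) 2 volume :=
    ((Lp.memLp f).of_measure_le_smul hK h).comp_of_map hχ.aemeasurable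
  LinearMap.mkContinuous
    { toFun := fun f => (hm f).toLp
      map_add' := fun f g => by
        refine Lp.ext ?_
        filter_upwards [(hm (f + g)).coeFn_toLp, (hm f).coeFn_toLp, (hm g).coeFn_toLp,
          Lp.coeFn_add (hm f).toLp (hm g).toLp, hq.ae_eq_comp (Lp.coeFn_add f g)]
          with x h1 h2 h3 h4 h5
        rw [h1, h4, Pi.add_apply, h2, h3, h5]
        rfl
      map_smul' := fun c f => by
        refine Lp.ext ?_
        filter_upwards [(hm (c • f)).coeFn_toLp, (hm f).coeFn_toLp,
          Lp.coeFn_smul c (hm f).toLp, hq.ae_eq_comp (Lp.coeFn_smul c f)] with x h1 h2 h3 h4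
        simp only [RingHom.id_apply]
        rw [h1, h3, Pi.smul_apply, h2, h4]
        rfl }
    (K ^ (1 / (2 : ℝ≥0∞)).toReal).toReal fun f => by
      simp only [LinearMap.coe_mk, AddHom.coe_mk, Lp.norm_def, ← ENNReal.toReal_mul]
      refine ENNReal.toReal_mono (by finiteness) ?_
      rw [eLpNorm_congr_ae (hm f).coeFn_toLp, ← eLpNorm_map_measure _ hχ.aemeasurable]
      · exact eLpNorm_le_of_measure_le_smul h
      · exact ((Lp.memLp f).of_measure_le_smul hK h).1

theorem coeFn_compL2 {χ : Euc d → Euc d} (hχ : Measurable χ) {K : ℝ≥0∞} (hK : K ≠ ⊤)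
    (h : Measure.map χ volume ≤ K • volume) (f : L2 d) :
    (compL2 hχ hK h f : Euc d → ℂ) =ᵐ[volume] f ∘ χ :=
  (((Lp.memLp f).of_measure_le_smul hK h).comp_of_map hχ.aemeasurable).coeFn_toLp

theorem hasDerivRule_compL2 {χ : Euc d → Euc d} (hχ : Measurable χ) {K : ℝ≥0∞} (hK : K ≠ ⊤)
    (h : Measure.map χ volume ≤ K • volume) (hd : Differentiable ℝ χ) (v : Euc d)
    (ha : ∀ i, MemLp (fun x => ((fderiv ℝ χ x v i : ℝ) : ℂ)) ⊤ volume) :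
    HasDerivRule v (compL2 hχ hK h) 0 (fun i => mulL2 (ha i) ∘L compL2 hχ hK h) := by
  intro u
  have hq : Measure.QuasiMeasurePreserving χ volume volume :=
    ⟨hχ, Measure.absolutelyContinuous_of_le_smul h⟩
  have hcu (w : 𝓢(Euc d, ℂ)) : (compL2 hχ hK h (w.toLp 2) : Euc d → ℂ) =ᵐ[volume]
      fun x => w (χ x) :=
    (coeFn_compL2 hχ hK h _).trans (hq.ae_eq_comp (w.coeFn_toLp 2 volume))
  have hfd (x : Euc d) : fderiv ℝ (fun x => u (χ x)) x v =
      ∑ i, ((fderiv ℝ χ x v i : ℝ) : ℂ) * (∂_{basisVec i} u) (χ x) := by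
    have e1 : fderiv ℝ (fun x => u (χ x)) x = (fderiv ℝ u (χ x)).comp (fderiv ℝ χ x) :=
      fderiv_comp x u.differentiableAt (hd x)
    have e2 : fderiv ℝ χ x v = ∑ i, (fderiv ℝ χ x v i) • basisVec i := by
      conv_lhs => rw [← (EuclideanSpace.basisFun (Fin d) ℝ).sum_repr (fderiv ℝ χ x v)]
      simp
    rw [e1, ContinuousLinearMap.comp_apply]
    conv_lhs => rw [e2]
    rw [map_sum]
    simp [SchwartzMap.lineDerivOp_apply_eq_fderiv]
  -- An L² representative `G` of the classical derivative supplies the integrability needed for the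
  -- integration by parts.
  have main (G : L2 d) (hG : (G : Euc d → ℂ) =ᵐ[volume] fun x => fderiv ℝ (fun x => u (χ x)) x v) :
      HasWeakDeriv v (compL2 hχ hK h (u.toLp 2)) G := by
    refine coe_eq_of_represents (Represents.congr_ae ?_ hG.symm)
    exact represents_lineDerivOp (Represents.congr_ae (represents_coe _) (hcu u))
      (fun x => (u.differentiableAt).comp x (hd x)) v
      fun g => (Represents.congr_ae (represents_coe G) hG g).1
  refine main _ ?_
  have h3 : ∀ᵐ x, ∀ i : Fin d, (compL2 hχ hK h ((∂_{basisVec i} u).toLp 2) : L2 d) x =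
      (∂_{basisVec i} u) (χ x) := ae_all_iff.2 fun i => hcu (∂_{basisVec i} u)
  simp only [zero_apply, zero_add, ContinuousLinearMap.comp_apply]
  filter_upwards [coeFn_sum_mulL2 ha fun i => compL2 hχ hK h ((∂_{basisVec i} u).toLp 2), h3]
    with x h1 h3
  rw [h1, hfd]
  exact Finset.sum_congr rfl fun i _ => by rw [h3 i]

/-! ### The Fourier transform of a product -/

/-- The Fourier transforms on `L¹` and on `L²` agree. -/
theorem fourier_ae_eq_of_integrable {p : L2 d} {q : Euc d → ℂ} (hq : Integrable q)
    (h : q =ᵐ[volume] p) : ((𝓕 p : L2 d) : Euc d → ℂ) =ᵐ[volume] 𝓕 q := by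
  refine ((represents_coe (𝓕 p : L2 d)).ae_eq (T := ((𝓕 p : L2 d) : 𝓢'(Euc d, ℂ))) ?_)
  rw [← Lp.fourier_toTemperedDistribution_eq]
  intro g
  have hb (x : Euc d) : ‖𝓕 q x‖ ≤ ∫ v, ‖q v‖ := by
    rw [Real.fourier_eq]
    refine (norm_integral_le_integral_norm _).trans_eq ?_
    simp
  have hc : Continuous (𝓕 q) :=
    VectorFourier.fourierIntegral_continuous Real.continuous_fourierChar
      (L := innerₗ (Euc d)) continuous_inner hq
  refine ⟨integrable_schwartz_mul_bounded g
    (memLp_top_of_bound hc.aestronglyMeasurable _ (.of_forall hb)), ?_⟩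
  rw [TemperedDistribution.fourier_apply, (represents_coe_iff.2 h _).2]
  have := VectorFourier.integral_fourierIntegral_smul_eq_flip (μ := volume) (ν := volume)
    (L := innerₗ (Euc d)) Real.continuous_fourierChar continuous_inner g.integrable hq
  simpa using! this

theorem fourier_mul_schwartz (b f : 𝓢(Euc d, ℂ)) (ξ : Euc d) :
    𝓕 (fun x => b x * f x) ξ = ∫ η, (𝓕 b) (ξ - η) * (𝓕 f) η := by
  have h1 := SchwartzMap.convolution_apply (ContinuousLinearMap.mul ℂ ℂ) (𝓕 f) (𝓕 b) ξ
  have hff (u : 𝓢(Euc d, ℂ)) (x : Euc d) : (𝓕 (𝓕 u)) x = u (-x) := by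
    have := congrArg (fun v : 𝓢(Euc d, ℂ) => v (-x)) ((fourierInv_fourier_eq u : (𝓕⁻ (𝓕 u : 𝓢(Euc d, ℂ)) : 𝓢(Euc d, ℂ)) = u))
    rw [← this, SchwartzMap.fourierInv_coe, Real.fourierInv_eq_fourier_neg, neg_neg]
    rfl
  have h2 : SchwartzMap.convolution (ContinuousLinearMap.mul ℂ ℂ) (𝓕 f) (𝓕 b) ξ =
      𝓕 (fun x => b x * f x) ξ := by
    -- The convolution is by definition the inverse transform of the product of the transforms, and
    -- transforming twice is reflection.
    have e : SchwartzMap.convolution (ContinuousLinearMap.mul ℂ ℂ) (𝓕 f) (𝓕 b) =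
      𝓕⁻ (SchwartzMap.pairing (ContinuousLinearMap.mul ℂ ℂ) (𝓕 (𝓕 f)) (𝓕 (𝓕 b))) := rfl
    rw [e, SchwartzMap.fourierInv_coe, Real.fourierInv_eq_fourier_comp_neg]
    refine congrFun (congrArg 𝓕 (funext fun x => ?_)) ξ
    simp [hff, mul_comm]
  rw [← h2, h1, convolution_def]
  refine integral_congr_ae (.of_forall fun η => ?_)
  simp [mul_comm]

theorem memLp_fourierChar (ξ : Euc d) :
    MemLp (fun x : Euc d => ((Real.fourierChar (-inner ℝ x ξ) : Circle) : ℂ)) ⊤ volume := by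
  refine memLp_top_of_bound ?_ 1 (.of_forall fun x => (Circle.norm_coe _).le)
  exact (continuous_subtype_val.comp (Real.continuous_fourierChar.comp
    (by fun_prop : Continuous fun x : Euc d => -inner ℝ x ξ))).aestronglyMeasurable

theorem measurePreserving_sub_left (ξ : Euc d) :
    MeasurePreserving (fun η : Euc d => ξ - η) volume volume :=
  Measure.measurePreserving_sub_left volume ξ

/-- For fixed `ξ` both sides are continuous bilinear forms in `(b, f)` on L², so it suffices to
compare them on Schwartz functions. -/
theorem integral_char_mul_eq_integral_fourier (b f : L2 d) (ξ : Euc d) :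
    ∫ x, ((Real.fourierChar (-inner ℝ x ξ) : Circle) : ℂ) * b x * f x =
      ∫ η, (𝓕 b : L2 d) (ξ - η) * (𝓕 f : L2 d) η := by
  have hmp := measurePreserving_sub_left ξ
  have hle : Measure.map (fun η : Euc d => ξ - η) volume ≤ (1 : ℝ≥0∞) • volume := by
    rw [hmp.map_eq, one_smul]
  let M := mulL2 (memLp_fourierChar ξ)
  let R := compL2 hmp.measurable ENNReal.one_ne_top hle
  let B := (ContinuousLinearMap.mul ℂ ℂ).lpPairing (volume : Measure (Euc d)) 2 2
  have hl (b f : L2 d) : B (M b) f = ∫ x, ((Real.fourierChar (-inner ℝ x ξ) : Circle) : ℂ) * b x * f x := by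
    rw [ContinuousLinearMap.lpPairing_eq_integral]
    refine integral_congr_ae ?_
    filter_upwards [coeFn_mulL2 (memLp_fourierChar ξ) b] with x hx
    simp [M, hx]
  have hr (b f : L2 d) : B (R b) f = ∫ η, b (ξ - η) * f η := by
    rw [ContinuousLinearMap.lpPairing_eq_integral]
    refine integral_congr_ae ?_
    filter_upwards [coeFn_compL2 hmp.measurable ENNReal.one_ne_top hle b] with x hx
    simp [R, hx]
  rw [← hl, ← hr]
  let Φ := (Lp.fourierTransformₗᵢ (Euc d) ℂ)
  change B (M b) f = B (R (Φ b)) (Φ f)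
  have hd := SchwartzMap.denseRange_toLpCLM (F := ℂ) (p := 2)
    (μ := (volume : Measure (Euc d))) (by simp)
  refine hd.induction_on₂ (p := fun b f => B (M b) f = B (R (Φ b)) (Φ f)) ?_ (fun b f => ?_) b f
  · refine isClosed_eq ?_ ?_
    · exact (B.continuous.comp (M.continuous.comp continuous_fst)).clm_apply continuous_snd
    · exact (B.continuous.comp (R.continuous.comp (Φ.continuous.comp continuous_fst))).clm_apply
        (Φ.continuous.comp continuous_snd)
  · rw [hl, hr]
    have e (u : 𝓢(Euc d, ℂ)) : Φ (SchwartzMap.toLpCLM ℝ ℂ 2 volume u) = (𝓕 u).toLp 2 volume :=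
      SchwartzMap.toLp_fourier_eq u
    rw [e, e]
    have h1 : ∫ x, ((Real.fourierChar (-inner ℝ x ξ) : Circle) : ℂ) * (b.toLp 2 volume) x * (f.toLp 2 volume) x =
        𝓕 (fun x => b x * f x) ξ := by
      rw [Real.fourier_eq]
      refine integral_congr_ae ?_
      filter_upwards [b.coeFn_toLp 2 volume, f.coeFn_toLp 2 volume] with x hb hf
      rw [hb, hf, Circle.smul_def, smul_eq_mul, mul_assoc]
    refine h1.trans ((fourier_mul_schwartz b f ξ).trans (integral_congr_ae ?_))
    filter_upwards [hmp.quasiMeasurePreserving.ae_eq_comp ((𝓕 b).coeFn_toLp 2 volume),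
      (𝓕 f).coeFn_toLp 2 volume] with η h1 h2
    rw [h2]
    congr 1
    exact h1.symm

theorem enorm_fourier_mul_le {b f p : L2 d} (h : (p : Euc d → ℂ) =ᵐ[volume] fun x => b x * f x) :
    ∀ᵐ ξ, ‖(𝓕 p : L2 d) ξ‖ₑ ≤ ∫⁻ η, ‖(𝓕 b : L2 d) (ξ - η)‖ₑ * ‖(𝓕 f : L2 d) η‖ₑ := by
  have hi : Integrable (fun x => b x * f x) volume :=
    (Lp.memLp b).integrable_mul (p := 2) (q := 2) (Lp.memLp f)
  filter_upwards [fourier_ae_eq_of_integrable hi h.symm] with ξ hξ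
  have e : 𝓕 (fun x => b x * f x) ξ = ∫ η, (𝓕 b : L2 d) (ξ - η) * (𝓕 f : L2 d) η := by
    rw [← integral_char_mul_eq_integral_fourier, Real.fourier_eq]
    refine integral_congr_ae (.of_forall fun x => ?_)
    simp only [Circle.smul_def, smul_eq_mul, mul_assoc]
  rw [hξ, e]
  refine (enorm_integral_le_lintegral_enorm _).trans_eq ?_
  simp_rw [enorm_mul]

/-! ### Young's inequality and products -/

/-- Cauchy–Schwarz for the measure G dη; integrated in ξ it gives Young's inequality L² * L¹ ⊂ L².
-/
theorem sq_lintegral_mul_le {A G : Euc d → ℝ≥0∞} (hA : Measurable A) (hG : Measurable G) :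
    (∫⁻ η, A η * G η) ^ 2 ≤ (∫⁻ η, A η ^ 2 * G η) * ∫⁻ η, G η := by
  have hpq : (2 : ℝ).HolderConjugate 2 := by constructor <;> norm_num
  have hs (x : ℝ≥0∞) : x ^ (1 / 2 : ℝ) * x ^ (1 / 2 : ℝ) = x := by
    rw [← ENNReal.rpow_add_of_nonneg _ _ (by norm_num) (by norm_num)]; norm_num
  have hs2 (x : ℝ≥0∞) : (x ^ (1 / 2 : ℝ)) ^ (2 : ℝ) = x := by
    rw [← ENNReal.rpow_mul]; norm_num
  have h := ENNReal.lintegral_mul_le_Lp_mul_Lq (volume : Measure (Euc d)) hpq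
    (f := fun η => A η * G η ^ (1 / 2 : ℝ)) (g := fun η => G η ^ (1 / 2 : ℝ))
    (hA.mul (hG.pow_const _)).aemeasurable (hG.pow_const _).aemeasurable
  simp only [Pi.mul_apply, mul_assoc, hs, hs2, ENNReal.mul_rpow_of_nonneg _ _ zero_le_two] at h
  calc _ ≤ ((∫⁻ η, A η ^ (2 : ℝ) * G η) ^ (1 / 2 : ℝ) * (∫⁻ η, G η) ^ (1 / 2 : ℝ)) ^ 2 := by gcongr
    _ = _ := by
      simp_rw [ENNReal.rpow_two]
      rw [mul_pow, sq (_ ^ _), sq (_ ^ _), hs, hs]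

theorem lintegral_sq_convolution_le {A G : Euc d → ℝ≥0∞} (hA : Measurable A) (hG : Measurable G) :
    ∫⁻ ξ, (∫⁻ η, A (ξ - η) * G η) ^ 2 ≤ (∫⁻ ξ, A ξ ^ 2) * (∫⁻ η, G η) ^ 2 := by
  have hm : Measurable fun p : Euc d × Euc d => A (p.1 - p.2) ^ 2 * G p.2 :=
    ((hA.comp (measurable_fst.sub measurable_snd)).pow_const 2).mul (hG.comp measurable_snd)
  calc ∫⁻ ξ, (∫⁻ η, A (ξ - η) * G η) ^ 2
      ≤ ∫⁻ ξ, (∫⁻ η, A (ξ - η) ^ 2 * G η) * ∫⁻ η, G η :=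
        lintegral_mono fun ξ => sq_lintegral_mul_le (hA.comp (measurable_const.sub measurable_id)) hG
    _ = (∫⁻ η, ∫⁻ ξ, A (ξ - η) ^ 2 * G η) * ∫⁻ η, G η := by
        rw [lintegral_mul_const _ hm.lintegral_prod_right', lintegral_lintegral_swap hm.aemeasurable]
    _ = _ := by
        have (η : Euc d) : ∫⁻ ξ, A (ξ - η) ^ 2 * G η = (∫⁻ ξ, A ξ ^ 2) * G η := by
          have hAη : Measurable fun ξ => A (ξ - η) ^ 2 :=
            (hA.comp (measurable_id.sub measurable_const)).pow_const 2
          rw [lintegral_mul_const _ hAη, lintegral_sub_right_eq_self (fun ξ => A ξ ^ 2) η]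
        simp_rw [this]
        rw [lintegral_const_mul _ hG]
        ring

theorem lintegral_sq_convolution_le' {A G : Euc d → ℝ≥0∞} (hA : Measurable A) (hG : Measurable G) :
    ∫⁻ ξ, (∫⁻ η, G (ξ - η) * A η) ^ 2 ≤ (∫⁻ ξ, A ξ ^ 2) * (∫⁻ η, G η) ^ 2 := by
  refine le_trans (le_of_eq (lintegral_congr fun ξ => ?_)) (lintegral_sq_convolution_le hA hG)
  rw [← lintegral_sub_left_eq_self (fun η => A (ξ - η) * G η) ξ]
  simp [mul_comm]

/-- Meant for x = 1+|ξ-η|², y = 1+|η|², z = 1+|ξ|², where z ≤ 4 max(x, y). If y ≤ x, then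
x^{(t-m)/2} ≤ y^{(t-m)/2} because t ≤ m; if x ≤ y, then y^{-1/2} ≤ x^{-1/2}. In each summand one
variable carries an extra power -m/2, which will make its factor integrable. -/
theorem weight_le_mul {m t x y z : ℝ} (ht : 1 ≤ t) (htm : t ≤ m) (hx : 1 ≤ x) (hy : 1 ≤ y)
    (hz : 0 ≤ z) (h : z ≤ 2 * (x + y)) :
    z ^ ((t - 1) / 2) ≤ 4 ^ ((t - 1) / 2) *
      (x ^ ((m - 1) / 2) * (y ^ (-m / 2) * y ^ (t / 2)) +
        x ^ (-m / 2) * x ^ ((m - 1) / 2) * y ^ (t / 2)) := by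
  have hx0 : 0 < x := by linarith
  have hy0 : 0 < y := by linarith
  have ht' : 0 ≤ (t - 1) / 2 := by linarith
  rcases le_total y x with hyx | hxy
  · calc z ^ ((t - 1) / 2) ≤ (4 * x) ^ ((t - 1) / 2) :=
          Real.rpow_le_rpow hz (by linarith) ht'
      _ = 4 ^ ((t - 1) / 2) * (x ^ ((m - 1) / 2) * x ^ (-m / 2 + t / 2)) := by
          rw [Real.mul_rpow (by norm_num) hx0.le, ← Real.rpow_add hx0]
          congr 2; ring
      _ ≤ 4 ^ ((t - 1) / 2) * (x ^ ((m - 1) / 2) * y ^ (-m / 2 + t / 2)) := by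
          gcongr 4 ^ ((t - 1) / 2) * (x ^ ((m - 1) / 2) * ?_)
          exact Real.rpow_le_rpow_of_nonpos hy0 hyx (by linarith)
      _ ≤ _ := by
          rw [Real.rpow_add hy0]
          gcongr
          exact le_add_of_nonneg_right (by positivity)
  · calc z ^ ((t - 1) / 2) ≤ (4 * y) ^ ((t - 1) / 2) :=
          Real.rpow_le_rpow hz (by linarith) ht'
      _ = 4 ^ ((t - 1) / 2) * (y ^ (-1 / 2 : ℝ) * y ^ (t / 2)) := by
          rw [Real.mul_rpow (by norm_num) hy0.le, ← Real.rpow_add hy0]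
          congr 2; ring
      _ ≤ 4 ^ ((t - 1) / 2) * (x ^ (-1 / 2 : ℝ) * y ^ (t / 2)) := by
          gcongr 4 ^ ((t - 1) / 2) * (?_ * _)
          exact Real.rpow_le_rpow_of_nonpos hx0 hxy (by norm_num)
      _ = 4 ^ ((t - 1) / 2) * (x ^ (-m / 2) * x ^ ((m - 1) / 2) * y ^ (t / 2)) := by
          rw [← Real.rpow_add hx0]
          congr 4; ring
      _ ≤ _ := by
          gcongr
          exact le_add_of_nonneg_left (by positivity)

/-- The weight `(1 + ‖ξ‖²)^(t/2)` with values in `[0, ∞]`. -/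
noncomputable def weight (t : ℝ) (ξ : Euc d) : ℝ≥0∞ := ENNReal.ofReal ((1 + ‖ξ‖ ^ 2) ^ (t / 2))

theorem measurable_weight (t : ℝ) : Measurable (weight (d := d) t) := by
  unfold weight
  fun_prop

theorem sobolevSq_eq_lintegral_weight (t : ℝ) (f : L2 d) :
    sobolevSq t f = ∫⁻ ξ, (weight t ξ * ‖(𝓕 f : L2 d) ξ‖ₑ) ^ 2 := by
  refine lintegral_congr fun ξ => ?_
  rw [mul_pow, weight, ← ENNReal.ofReal_pow (by positivity), ← Real.rpow_mul_natCast (by positivity)]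
  congr 3; push_cast; ring

/-- Cauchy–Schwarz: (1+|ξ|²)^{-m} is integrable since 2m > d. -/
theorem lintegral_weight_mul_ne_top {m : ℝ} (hm : (d : ℝ) < 2 * m) {F : Euc d → ℝ≥0∞}
    (hF : Measurable F) (hF' : ∫⁻ ξ, F ξ ^ 2 ≠ ⊤) : ∫⁻ ξ, weight (-m) ξ * F ξ ≠ ⊤ := by
  have hpq : (2 : ℝ).HolderConjugate 2 := by constructor <;> norm_num
  have h := ENNReal.lintegral_mul_le_Lp_mul_Lq (volume : Measure (Euc d)) hpq
    (measurable_weight (-m)).aemeasurable hF.aemeasurable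
  refine ne_top_of_le_ne_top (ENNReal.mul_ne_top ?_ ?_) h
  · refine ENNReal.rpow_ne_top_of_nonneg (by norm_num) ?_
    have hi := integrable_rpow_neg_one_add_norm_sq (E := Euc d) (μ := volume) (r := 2 * m)
      (by simpa using hm)
    refine ne_of_eq_of_ne (lintegral_congr fun ξ => ?_) hi.lintegral_lt_top.ne
    rw [weight, ENNReal.ofReal_rpow_of_nonneg (by positivity) (by norm_num),
      ← Real.rpow_mul (by positivity)]
    congr 2; ring
  · refine ENNReal.rpow_ne_top_of_nonneg (by norm_num) ?_
    simpa using hF'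

theorem sobolevSq_mul_ne_top {m t : ℝ} (hm : (d : ℝ) < 2 * m) (ht : 1 ≤ t) (htm : t ≤ m)
    {b f p : L2 d} (hb : sobolevSq (m - 1) b ≠ ⊤) (hf : sobolevSq t f ≠ ⊤)
    (h : (p : Euc d → ℂ) =ᵐ[volume] fun x => b x * f x) : sobolevSq (t - 1) p ≠ ⊤ := by
  have hmeas (u : L2 d) : Measurable fun ξ => ‖(u : Euc d → ℂ) ξ‖ₑ := (Lp.stronglyMeasurable u).enorm
  let B : Euc d → ℝ≥0∞ := fun ξ => weight (m - 1) ξ * ‖(𝓕 b : L2 d) ξ‖ₑ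
  let F : Euc d → ℝ≥0∞ := fun ξ => weight t ξ * ‖(𝓕 f : L2 d) ξ‖ₑ
  have hB : Measurable B := (measurable_weight _).mul (hmeas _)
  have hF : Measurable F := (measurable_weight _).mul (hmeas _)
  have hB2 : ∫⁻ ξ, B ξ ^ 2 ≠ ⊤ := by rwa [← sobolevSq_eq_lintegral_weight]
  have hF2 : ∫⁻ ξ, F ξ ^ 2 ≠ ⊤ := by rwa [← sobolevSq_eq_lintegral_weight]
  -- `B` and `F` are in L², `B'` and `F'` in L¹; each half of the weight inequality becomes an L² *
  -- L¹ convolution.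
  let B' : Euc d → ℝ≥0∞ := fun ξ => weight (-m) ξ * B ξ
  let F' : Euc d → ℝ≥0∞ := fun ξ => weight (-m) ξ * F ξ
  have hB' : Measurable B' := (measurable_weight _).mul hB
  have hF' : Measurable F' := (measurable_weight _).mul hF
  have hB1 : ∫⁻ ξ, B' ξ ≠ ⊤ := lintegral_weight_mul_ne_top hm hB hB2
  have hF1 : ∫⁻ ξ, F' ξ ≠ ⊤ := lintegral_weight_mul_ne_top hm hF hF2
  let c : ℝ≥0∞ := ENNReal.ofReal (4 ^ ((t - 1) / 2))
  have hpt (ξ η : Euc d) : weight (t - 1) ξ * (‖(𝓕 b : L2 d) (ξ - η)‖ₑ * ‖(𝓕 f : L2 d) η‖ₑ) ≤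
      c * (B (ξ - η) * F' η + B' (ξ - η) * F η) := by
    have hw : weight (t - 1) ξ ≤ c * (weight (m - 1) (ξ - η) * (weight (-m) η * weight t η) +
        weight (-m) (ξ - η) * weight (m - 1) (ξ - η) * weight t η) := by
      simp only [weight, c]
      rw [← ENNReal.ofReal_mul (by positivity), ← ENNReal.ofReal_mul (by positivity),
        ← ENNReal.ofReal_mul (by positivity), ← ENNReal.ofReal_mul (by positivity),
        ← ENNReal.ofReal_add (by positivity) (by positivity), ← ENNReal.ofReal_mul (by positivity)]
      refine ENNReal.ofReal_le_ofReal (weight_le_mul ht htm (by simp) (by simp) (by positivity) ?_)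
      have h1 : ‖ξ‖ ≤ ‖ξ - η‖ + ‖η‖ := by simpa using norm_add_le (ξ - η) η
      nlinarith [norm_nonneg ξ, norm_nonneg η, norm_nonneg (ξ - η), sq_nonneg (‖ξ - η‖ - ‖η‖)]
    calc _ ≤ c * (weight (m - 1) (ξ - η) * (weight (-m) η * weight t η) +
        weight (-m) (ξ - η) * weight (m - 1) (ξ - η) * weight t η) *
          (‖(𝓕 b : L2 d) (ξ - η)‖ₑ * ‖(𝓕 f : L2 d) η‖ₑ) := by gcongr
      _ = _ := by simp only [B, B', F, F']; ring
  have hconv (ξ : Euc d) : AEMeasurable (fun η => B (ξ - η) * F' η) volume :=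
    ((hB.comp (measurable_const.sub measurable_id)).mul hF').aemeasurable
  have hmc : Measurable fun ξ => ∫⁻ η, B (ξ - η) * F' η :=
    Measurable.lintegral_prod_right' (f := fun p : Euc d × Euc d => B (p.1 - p.2) * F' p.2)
      ((hB.comp (measurable_fst.sub measurable_snd)).mul (hF'.comp measurable_snd))
  have hsq (x y : ℝ≥0∞) : (x + y) ^ 2 ≤ 2 * (x ^ 2 + y ^ 2) := by
    have := ENNReal.rpow_add_le_mul_rpow_add_rpow x y (p := 2) one_le_two
    norm_num at this
    exact this
  have hle : sobolevSq (t - 1) p ≤ c ^ 2 * (2 * ((∫⁻ ξ, (∫⁻ η, B (ξ - η) * F' η) ^ 2) +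
      ∫⁻ ξ, (∫⁻ η, B' (ξ - η) * F η) ^ 2)) := by
    rw [sobolevSq_eq_lintegral_weight, ← lintegral_add_left (hmc.pow_const 2),
      ← lintegral_const_mul' _ _ (by simp), ← lintegral_const_mul' _ _ (by simp [c])]
    refine lintegral_mono_ae ?_
    filter_upwards [enorm_fourier_mul_le h] with ξ hξ
    calc (weight (t - 1) ξ * ‖(𝓕 p : L2 d) ξ‖ₑ) ^ 2
        ≤ (∫⁻ η, c * (B (ξ - η) * F' η + B' (ξ - η) * F η)) ^ 2 := by
          gcongr
          refine (mul_le_mul_right hξ _).trans ?_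
          rw [← lintegral_const_mul' _ _ (by simp [weight])]
          exact lintegral_mono fun η => hpt ξ η
      _ = c ^ 2 * ((∫⁻ η, B (ξ - η) * F' η) + ∫⁻ η, B' (ξ - η) * F η) ^ 2 := by
          rw [lintegral_const_mul' _ _ (by simp [c]), lintegral_add_left' (hconv ξ), mul_pow]
      _ ≤ _ := by gcongr; exact hsq _ _
  refine ne_top_of_le_ne_top ?_ (hle.trans (mul_le_mul_right (mul_le_mul_right (add_le_add
    (lintegral_sq_convolution_le hB hF') (lintegral_sq_convolution_le' hF hB')) _) _))
  have hc : c ≠ ⊤ := by simp [c]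
  finiteness

/-! ### Induction on the Sobolev order, and multipliers -/

theorem sobolevSq_add_ne_top {t : ℝ} {f g : L2 d} (hf : sobolevSq t f ≠ ⊤)
    (hg : sobolevSq t g ≠ ⊤) : sobolevSq t (f + g) ≠ ⊤ := by
  rw [← memSobolev_coe_iff, ← Lp.toTemperedDistributionCLM_apply, map_add]
  exact (memSobolev_coe_iff.2 hf).add (memSobolev_coe_iff.2 hg)

theorem sobolevSq_zero_ne_top (t : ℝ) : sobolevSq t (0 : L2 d) ≠ ⊤ := by
  rw [← memSobolev_coe_iff, ← Lp.toTemperedDistributionCLM_apply, map_zero]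
  exact memSobolev_fun_zero _ _ _ _

theorem sobolevSq_sum_ne_top {t : ℝ} {ι : Type*} (s : Finset ι) {f : ι → L2 d}
    (hf : ∀ i ∈ s, sobolevSq t (f i) ≠ ⊤) : sobolevSq t (∑ i ∈ s, f i) ≠ ⊤ :=
  Finset.sum_induction f (fun u => sobolevSq t u ≠ ⊤) (fun _ _ => sobolevSq_add_ne_top)
    (sobolevSq_zero_ne_top t) hf

theorem sobolevSq_ne_top_of_hasWeakDeriv {t : ℝ} {f : L2 d} {g : Fin d → L2 d}
    (h : ∀ j, HasWeakDeriv (basisVec j) f (g j)) (hf : sobolevSq (t - 1) f ≠ ⊤)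
    (hg : ∀ j, sobolevSq (t - 1) (g j) ≠ ⊤) : sobolevSq t f ≠ ⊤ := by
  rw [sobolevSq_eq_add_sum h]
  exact ENNReal.add_ne_top.2 ⟨hf, ENNReal.mul_ne_top (by simp) (ENNReal.sum_ne_top.2 fun j _ => hg j)⟩

/-- Induction on the order: an operator preserves `H^t` if it satisfies a derivative rule whose
operators map `H^t` and `H^{t-1}` to `H^{t-1}` as soon as the operator itself preserves
`H^{t-1}`. -/
theorem sobolevSq_map_ne_top_of_step {T : L2 d →L[ℂ] L2 d} {A₀ : Fin d → L2 d →L[ℂ] L2 d}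
    {A : Fin d → Fin d → L2 d →L[ℂ] L2 d}
    (hT : ∀ j, HasDerivRule (basisVec j) T (A₀ j) (A j)) {m : ℝ}
    (h₀ : ∀ t, 1 ≤ t → t ≤ m → ∀ j f, sobolevSq t f ≠ ⊤ → sobolevSq (t - 1) (A₀ j f) ≠ ⊤)
    (h : ∀ t, 1 ≤ t → t ≤ m → (∀ f, sobolevSq (t - 1) f ≠ ⊤ → sobolevSq (t - 1) (T f) ≠ ⊤) →
      ∀ j i f, sobolevSq (t - 1) f ≠ ⊤ → sobolevSq (t - 1) (A j i f) ≠ ⊤)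
    {t : ℝ} (ht0 : 0 ≤ t) (htm : t ≤ m) {f : L2 d} (hf : sobolevSq t f ≠ ⊤) :
    sobolevSq t (T f) ≠ ⊤ := by
  -- The real order is lowered by one at a time until it lies in [0, 1], where interpolation
  -- applies; `n` only bounds the number of steps.
  obtain ⟨n, hn⟩ := exists_nat_ge t
  induction n generalizing t f with
  | zero => exact sobolevSq_map_ne_top_of_le_one hT ht0 (hn.trans (by simp)) hf
  | succ n ih =>
    rcases le_or_gt t 1 with ht1 | ht1
    · exact sobolevSq_map_ne_top_of_le_one hT ht0 ht1 hf
    have ih' : ∀ f, sobolevSq (t - 1) f ≠ ⊤ → sobolevSq (t - 1) (T f) ≠ ⊤ := fun f hf =>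
      ih (by linarith) (by linarith) hf (by push_cast at hn; linarith)
    choose g hg hg' using fun j => exists_hasWeakDeriv ht1.le hf (basisVec (d := d) j)
    refine sobolevSq_ne_top_of_hasWeakDeriv (fun j => (hT j).hasWeakDeriv hg)
      (ih' f (ne_top_of_le_ne_top hf (sobolevSq_mono (by linarith) f))) fun j => ?_
    exact sobolevSq_add_ne_top (h₀ t ht1.le htm j f hf)
      (sobolevSq_sum_ne_top _ fun i _ => h t ht1.le htm ih' j i _ (hg' i))

/-- Bounded functions with bounded gradient in `H^{m-1}`, `m > d/2`, are multipliers of `H^t` for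
`0 ≤ t ≤ m`. -/
theorem sobolevSq_mulL2_ne_top {a : Euc d → ℂ} (ha : MemLp a ⊤ volume) {T : 𝓢'(Euc d, ℂ)}
    (hT : Represents T a) {h : Fin d → Euc d → ℂ} (hh : ∀ j, MemLp (h j) ⊤ volume)
    (hT' : ∀ j, Represents (∂_{basisVec j} T) (h j)) {m : ℝ} (hm : (d : ℝ) < 2 * m)
    (hb : 1 ≤ m → ∀ j, ∃ b : L2 d, h j =ᵐ[volume] b ∧ sobolevSq (m - 1) b ≠ ⊤)
    {t : ℝ} (ht0 : 0 ≤ t) (htm : t ≤ m) {f : L2 d} (hf : sobolevSq t f ≠ ⊤) :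
    sobolevSq t (mulL2 ha f) ≠ ⊤ := by
  refine sobolevSq_map_ne_top_of_step (fun j => hasDerivRule_mulL2 ha (hh j) hT j (hT' j))
    ?_ ?_ ht0 htm hf
  · intro t ht1 htm j f hf
    -- The gradient is used only for orders 1 ≤ t ≤ m; if m < 1 interpolation alone covers the
    -- range.
    obtain ⟨b, hb, hb'⟩ := hb (ht1.trans htm) j
    refine sobolevSq_mul_ne_top hm ht1 htm hb' hf ?_
    filter_upwards [coeFn_mulL2 (hh j) f, hb] with x h1 h2
    rw [h1, h2]
  · intro t _ _ ih j i f hf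
    split_ifs
    · exact ih f hf
    · exact sobolevSq_zero_ne_top _

/-! ### Consequences of the hypotheses on `χ` -/

theorem _root_.Represents.memLp_top {T : 𝓢'(Euc d, ℂ)} {f : Euc d → ℂ} (hf : Represents T f)
    {C : ℝ} (hC : ∀ x, ‖f x‖ ≤ C) : MemLp f ⊤ volume :=
  memLp_top_of_bound hf.locallyIntegrable.aestronglyMeasurable C (.of_forall hC)

theorem exists_of_inWInfty_one {f : Euc d → ℂ} (hf : InWInfty 1 f) :
    MemLp f ⊤ volume ∧ ∃ T : 𝓢'(Euc d, ℂ), Represents T f ∧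
      ∀ v : Euc d, ∃ h : Euc d → ℂ, Represents (∂_{v} T) h ∧ MemLp h ⊤ volume := by
  obtain ⟨T, hT, H⟩ := hf
  refine ⟨?_, T, hT, fun v => ?_⟩
  · obtain ⟨h, C, hh, hC, -⟩ := H 0 (Nat.zero_le _) ![]
    rw [LineDeriv.iteratedLineDerivOp_fin_zero] at hh
    exact (hh.memLp_top hC).ae_eq (hh.ae_eq hT)
  · obtain ⟨h, C, hh, hC, -⟩ := H 1 (by simp) ![v]
    rw [LineDeriv.iteratedLineDerivOp_one] at hh
    exact ⟨h, hh, hh.memLp_top hC⟩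

/-- Change of variables with the Jacobian of `χ.symm`; the determinant is continuous, hence bounded
on the compact ball of linear maps of norm at most `C`. -/
theorem exists_map_le_smul_volume (χ : Euc d ≃ Euc d) (hχ : Measurable χ)
    (hs : Differentiable ℝ χ.symm) {C : ℝ} (hC : ∀ y, ‖fderiv ℝ χ.symm y‖ ≤ C) :
    ∃ K : ℝ≥0∞, K ≠ ⊤ ∧ Measure.map χ volume ≤ K • (volume : Measure (Euc d)) := by
  have : ProperSpace (Euc d →L[ℝ] Euc d) := FiniteDimensional.proper ℝ _
  obtain ⟨D, hD⟩ := (isCompact_closedBall (0 : Euc d →L[ℝ] Euc d) C).exists_bound_of_continuousOn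
    (f := fun A => A.det) ContinuousLinearMap.continuous_det.continuousOn
  refine ⟨ENNReal.ofReal D, ENNReal.ofReal_ne_top, Measure.le_iff.2 fun s hms => ?_⟩
  rw [Measure.map_apply hχ hms, ← Equiv.image_symm_eq_preimage]
  calc volume (χ.symm '' s)
      ≤ ∫⁻ y in s, ENNReal.ofReal |(fderiv ℝ χ.symm y).det| :=
        addHaar_image_le_lintegral_abs_det_fderiv volume hms
          fun y _ => (hs y).hasFDerivAt.hasFDerivWithinAt
    _ ≤ ∫⁻ _ in s, ENNReal.ofReal D :=
        lintegral_mono fun y => ENNReal.ofReal_le_ofReal (hD _ (by simpa using hC y))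
    _ = (ENNReal.ofReal D • volume) s := by simp

theorem fderiv_component {χ : Euc d → Euc d} (hχ : Differentiable ℝ χ) (i : Fin d) (x v : Euc d) :
    fderiv ℝ (component χ i) x v = ((fderiv ℝ χ x v i : ℝ) : ℂ) := by
  have h : HasFDerivAt (component χ i)
      ((Complex.ofRealCLM ∘L EuclideanSpace.proj i) ∘L fderiv ℝ χ x) x :=
    (Complex.ofRealCLM ∘L EuclideanSpace.proj (𝕜 := ℝ) i).hasFDerivAt.comp x (hχ x).hasFDerivAt
  rw [h.fderiv]
  rfl

end SobolevComposition

/-! ### The composition theorem -/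

open SobolevComposition in
theorem corollary2 (d : ℕ) (s : ℝ) (hs : 1 + (d : ℝ) / 2 < s)
    (φ : Euc d → ℂ) (hφ : InHs s φ)
    -- `χ` is a diffeomorphism of `ℝ^d` whose inverse has a bounded derivative
    (χ : Euc d ≃ Euc d) (hχ : ContDiff ℝ 1 χ) (hχ_symm : ContDiff ℝ 1 χ.symm)
    (hχ_inv : ∃ C : ℝ, ∀ y, ‖fderiv ℝ χ.symm y‖ ≤ C)
    -- `χ ∈ W^{1+s-d/2,∞}_loc`
    (hχ_loc : ∀ i, InWInftyLoc (1 + s - (d : ℝ) / 2) (component χ i))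
    -- `Dχ ∈ W^{1,∞}`
    (hDχ : ∀ (i : Fin d) (v : Euc d), InWInfty 1 (fun x => ((fderiv ℝ χ x v i : ℝ) : ℂ)))
    -- `D²χ ∈ H^{s-2}`
    (hD2χ : HessianInHs (s - 2) χ) :
    InHs s (φ ∘ χ) := by
  have hd0 : (0 : ℝ) ≤ d := d.cast_nonneg
  have hs0 : 0 ≤ s := by linarith
  have hdiff : Differentiable ℝ χ := hχ.differentiable one_ne_zero
  have hmeas : Measurable χ := hχ.continuous.measurable
  obtain ⟨C, hC⟩ := hχ_inv
  obtain ⟨K, hK, hle⟩ := exists_map_le_smul_volume χ hmeas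
    (hχ_symm.differentiable one_ne_zero) hC
  obtain ⟨F, hF, hFs⟩ := (inHs_iff hs0).1 hφ
  have hq : Measure.QuasiMeasurePreserving χ volume volume :=
    ⟨hmeas, Measure.absolutelyContinuous_of_le_smul hle⟩
  refine (inHs_iff hs0).2 ⟨compL2 hmeas hK hle F,
    (hq.ae_eq_comp hF).trans (coeFn_compL2 hmeas hK hle F).symm, ?_⟩
  have ha (i j : Fin d) := (exists_of_inWInfty_one (hDχ i (basisVec j))).1
  have hmul (i j : Fin d) {t : ℝ} (ht0 : 0 ≤ t) (hts : t ≤ s - 1) {f : L2 d}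
      (hf : sobolevSq t f ≠ ⊤) : sobolevSq t (mulL2 (ha i j) f) ≠ ⊤ := by
    obtain ⟨-, T, hT, H⟩ := exists_of_inWInfty_one (hDχ i (basisVec j))
    choose h hh hhb using fun k => H (basisVec (d := d) k)
    refine sobolevSq_mulL2_ne_top (ha i j) hT hhb hh (m := s - 1) (by linarith)
      (fun hs1 k => ?_) ht0 hts hf
    obtain ⟨S, hS, hS'⟩ := hD2χ i
    -- The distributions given by the two hypotheses are both represented by ∂ⱼχᵢ, so the bounded
    -- gradient of `T` is also the part of D²χ lying in H^{s-2}.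
    have hST : ∂_{basisVec j} S = T := by
      have hrep := represents_lineDerivOp hS
        (((Complex.ofRealCLM ∘L EuclideanSpace.proj (𝕜 := ℝ) i).differentiable).comp hdiff)
        (basisVec j) fun g => by
          refine (integrable_schwartz_mul_bounded g (ha i j)).congr (.of_forall fun x => ?_)
          exact congrArg (g x * ·) (fderiv_component hdiff i x (basisVec j)).symm
      ext g
      rw [(hrep g).2, (hT g).2]
      exact integral_congr_ae (.of_forall fun x =>
        congrArg (g x * ·) (fderiv_component hdiff i x (basisVec j)))
    have hb := hS' (basisVec k) (basisVec j)
    rw [hST] at hb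
    -- `hs1` says s - 2 ≥ 0, so the second derivative is an L² function.
    obtain ⟨b, hb'⟩ := memSobolev_zero_iff.1 (hb.mono (by linarith))
    rw [hb'] at hb
    refine ⟨b, represents_coe_iff.1 (hb' ▸ hh k), ?_⟩
    rw [show s - 1 - 1 = s - 2 by ring]
    exact memSobolev_coe_iff.1 hb
  -- The chain rule has no zeroth-order term, so only the multiplication by ∂ⱼχᵢ at order t - 1 ≤ s
  -- - 1 is left.
  refine sobolevSq_map_ne_top_of_step
    (fun j => hasDerivRule_compL2 hmeas hK hle hdiff (basisVec j) fun i => ha i j)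
    (m := s) (fun t _ _ j f _ => sobolevSq_zero_ne_top _) ?_ hs0 le_rfl hFs
  intro t ht1 hts ih j i f hf
  exact hmul i j (by linarith) (by linarith) (ih f hf)
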